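/- Let $A$ be a finite alphabet and $p\ge 2$. Let $\tau:A\to A^+$ be a substitution of constant length $p$ (that is, $|\tau(a)|=p$ for all $a\in A$), extended to words by concatenation. Assume that $\tau$ is one-to-one ($\tau(a)\neq\tau(b)$ for letters $a\neq b$) and primitive (there is $n\in\mathbb N$ such that $a$ appears in $\tau^n(b)$ for all $a,b\in A$). Let $X_\tau\subseteq A^{\mathbb Z}$ be the subshift generated by $\tau$, i.e. the set of all $x\in A^{\mathbb Z}$ each of whose finite sub-words is a sub-word of $\tau^m(a)$ for some $m\in\mathbb N$, $a\in A$, and assume that $X_\tau$ is infinite. Let $T$ be the shift, $(Tx)_i=x_{i+1}$, and let $\varrho$ be the metric on $A^{\mathbb Z}$ with $\varrho(x,y)=2^{-\min\{|i|\,:\,x_i\neq y_i\}}$ for $x\ne y$. A pair $(x,y)\in X_\tau\times X_\tau$ is a Li–Yorke pair if $\limsup_{n\to\infty}\varrho(T^nx,T^ny)>0$ and $\liminf_{n\to\infty}\varrho(T^nx,T^ny)=0$; its orbit is $\{(T^nx,T^ny):n\in\mathbb Z\}$. Then the set of orbits of Li–Yorke pairs of $X_\tau$ is either finite or uncountable.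 Moreover, the set of Li–Yorke pairs is uncountable if and only if there exist $m\in\mathbb N$, letters $a\neq b$ in $A$ and (possibly empty) words $u,v,w,u',v',w'$ with $|u|=|u'|$, $|v|=|v'|$, $|w|=|w'|$ such that $$\tau^m(a)=uavaw,\qquad \tau^m(b)=u'bv'bw',$$ and the words $vaw$ and $v'bw'$ have a coincidence, i.e. carry the same letter at some common coordinate. -/

import Mathlib

namespace Substitution

open Filter

/-- The substitution `τ : A → A⁺` extended to finite words by concatenation. -/
def onWord {A : Type*} (τ : A → List A) (w : List A) : List A := w.flatMap τ

/-- The word `τⁿ(a)`; in particular `τ⁰(a) = a`. -/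
def iter {A : Type*} (τ : A → List A) (n : ℕ) (a : A) : List A := (onWord τ)^[n] [a]

/-- Constant length `p`, with `p ≥ 2`. -/
def IsConstantLength {A : Type*} (τ : A → List A) (p : ℕ) : Prop :=
  2 ≤ p ∧ ∀ a, (τ a).length = p

/-- `τ` is primitive: for one `n`, every letter `a` appears in every word `τⁿ(b)`. -/
def IsPrimitive {A : Type*} (τ : A → List A) : Prop :=
  ∃ n : ℕ, ∀ a b : A, a ∈ iter τ n b

/-- The shift `T` on `A^ℤ`, `(T x)ᵢ = xᵢ₊₁`, as a bijection. -/
def shift {A : Type*} : Equiv.Perm (ℤ → A) where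
  toFun x := fun i => x (i + 1)
  invFun x := fun i => x (i - 1)
  left_inv x := by funext i; simp
  right_inv x := by funext i; simp

/-- The word `x_k x_{k+1} … x_{k+n-1}` of length `n`. -/
def word {A : Type*} (x : ℤ → A) (k : ℤ) (n : ℕ) : List A :=
  List.ofFn fun i : Fin n => x (k + (i : ℕ))

/-- The subshift `X_τ ⊆ A^ℤ`: the two-sided sequences all of whose finite sub-words are sub-words
of some `τᵐ(a)`. For a primitive substitution of constant length this is the smallest subshift in
which all the words `τᵐ(a)` appear; see `isLeast_subshift` below. -/
def subshift {A : Type*} (τ : A → List A) : Set (ℤ → A) :=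
  {x | ∀ (k : ℤ) (n : ℕ), ∃ (m : ℕ) (a : A), word x k n <:+: iter τ m a}

/-- The usual metric on `A^ℤ`: `2 ^ (-min {|i| : xᵢ ≠ yᵢ})` if `x ≠ y`, and `0` if `x = y`. -/
noncomputable def seqDist {A : Type*} (x y : ℤ → A) : ℝ :=
  open Classical in
  if x = y then 0 else (1 / 2 : ℝ) ^ sInf {n : ℕ | ∃ i : ℤ, i.natAbs = n ∧ x i ≠ y i}

/-- `(x, y)` is a Li–Yorke pair of `T` for the (bounded) metric `ϱ`. -/
def IsLiYorkePair {X : Type*} (ϱ : X → X → ℝ) (T : X → X) (x y : X) : Prop :=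
  0 < limsup (fun n : ℕ => ϱ (T^[n] x) (T^[n] y)) atTop ∧
    liminf (fun n : ℕ => ϱ (T^[n] x) (T^[n] y)) atTop = 0

/-- The set `LY(X_τ, T) ⊆ X_τ × X_τ` of Li–Yorke pairs. -/
def liYorkePairs {A : Type*} (τ : A → List A) : Set ((ℤ → A) × (ℤ → A)) :=
  {q | q.1 ∈ subshift τ ∧ q.2 ∈ subshift τ ∧ IsLiYorkePair seqDist shift q.1 q.2}

/-- The orbit of a pair under `T × T`. -/
def pairOrbit {A : Type*} (q : (ℤ → A) × (ℤ → A)) : Set ((ℤ → A) × (ℤ → A)) :=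
  {r | ∃ n : ℤ, r = ((shift ^ n) q.1, (shift ^ n) q.2)}

/-- Two words of the same length have a coincidence: some coordinate carries the same letter. -/
def HaveCoincidence {A : Type*} (u u' : List A) : Prop :=
  u.length = u'.length ∧ ∃ (i : ℕ) (c : A), u[i]? = some c ∧ u'[i]? = some c

/-- For some `m` and letters `a ≠ b`, `τᵐ(a) = u a v a w` and `τᵐ(b) = u' b v' b w'` with
`|u| = |u'|`, `|v| = |v'|`, `|w| = |w'|`, where `v a w` and `v' b w'` have a coincidence. The
words `u, v, w, u', v', w'` may be empty. -/
def CoincidenceCondition {A : Type*} (τ : A → List A) : Prop :=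
  ∃ (m : ℕ) (a b : A), a ≠ b ∧ ∃ u v w u' v' w' : List A,
    iter τ m a = u ++ [a] ++ v ++ [a] ++ w ∧
    iter τ m b = u' ++ [b] ++ v' ++ [b] ++ w' ∧
    u.length = u'.length ∧ v.length = v'.length ∧ w.length = w'.length ∧
    HaveCoincidence (v ++ [a] ++ w) (v' ++ [b] ++ w')

/-- A subshift: a shift-invariant subset of `A^ℤ`, closed for the product of the discrete
topologies. -/
def IsSubshift {A : Type*} (S : Set (ℤ → A)) : Prop :=
  @IsClosed (ℤ → A) (@Pi.topologicalSpace ℤ (fun _ => A) (fun _ => ⊥)) S ∧ shift '' S = S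

/-- The finite word `w` appears in `S`: it is a sub-word of a point of `S`. -/
def Appears {A : Type*} (w : List A) (S : Set (ℤ → A)) : Prop :=
  ∃ x ∈ S, ∃ k : ℤ, word x k w.length = w

theorem iterate_append {A : Type*} (τ : A → List A) (n : ℕ) (u v : List A) :
    (onWord τ)^[n] (u ++ v) = (onWord τ)^[n] u ++ (onWord τ)^[n] v := by
  induction n generalizing u v with
  | zero => rfl
  | succ n ih => simp only [Function.iterate_succ_apply]; rw [← ih]; simp [onWord]

theorem iterate_iter {A : Type*} (τ : A → List A) (m n : ℕ) (a : A) :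
    (onWord τ)^[m] (iter τ n a) = iter τ (m + n) a := by
  simp [iter, Function.iterate_add_apply]

theorem iter_infix {A : Type*} (τ : A → List A) {m n : ℕ} {a b : A} (h : b ∈ iter τ n a) :
    iter τ m b <:+: iter τ (m + n) a := by
  obtain ⟨s, t, hst⟩ := List.append_of_mem h
  refine ⟨(onWord τ)^[m] s, (onWord τ)^[m] t, ?_⟩
  rw [← iterate_iter, hst, List.append_cons, iterate_append, iterate_append]
  rfl

theorem length_iterate {A : Type*} {τ : A → List A} {p : ℕ} (hp : IsConstantLength τ p) (n : ℕ)
    (w : List A) : ((onWord τ)^[n] w).length = p ^ n * w.length := by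
  induction n generalizing w with
  | zero => simp
  | succ n ih =>
    rw [Function.iterate_succ_apply, ih]
    have : (onWord τ w).length = p * w.length := by
      simp [onWord, List.length_flatMap, hp.2, mul_comm]
    rw [this]; ring

/-- Every letter occurs strictly inside some iterate of itself. -/
theorem exists_interior {A : Type*} {τ : A → List A} {p : ℕ} (hp : IsConstantLength τ p)
    (hprim : IsPrimitive τ) (a : A) :
    ∃ (K : ℕ) (u v : List A), iter τ K a = u ++ [a] ++ v ∧ u ≠ [] ∧ v ≠ [] := by
  obtain ⟨N, hN⟩ := hprim
  have hl : (iter τ 2 a).length = p ^ 2 := by rw [iter, length_iterate hp]; simp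
  have h4 : 2 ^ 2 ≤ p ^ 2 := Nat.pow_le_pow_left hp.1 2
  obtain ⟨c, b, d, r, hcd⟩ : ∃ (c b d : A) (r : List A), iter τ 2 a = [c, b] ++ d :: r := by
    match h : iter τ 2 a with
    | [] | [_] | [_, _] => simp [h] at hl; omega
    | c :: b :: d :: r => exact ⟨c, b, d, r, by simp⟩
  obtain ⟨s, t, hst⟩ := List.append_of_mem (hN a b)
  have hne : ∀ w : List A, w ≠ [] → (onWord τ)^[N] w ≠ [] := by
    intro w hw h
    have h1 := length_iterate hp N w
    rw [h] at h1
    have h2 : 0 < p ^ N := Nat.pow_pos (by have := hp.1; omega)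
    have h3 := List.length_pos_iff.2 hw
    simp only [List.length_nil] at h1
    have := Nat.mul_pos h2 h3
    omega
  refine ⟨N + 2, (onWord τ)^[N] [c] ++ s, t ++ (onWord τ)^[N] (d :: r), ?_, ?_, ?_⟩
  · rw [← iterate_iter, hcd]
    have : [c, b] ++ d :: r = [c] ++ ([b] ++ d :: r) := rfl
    rw [this, iterate_append, iterate_append]
    have hb : (onWord τ)^[N] [b] = s ++ a :: t := hst
    rw [hb]; simp
  · have := hne [c] (by simp); simp [this]
  · have := hne (d :: r) (by simp); simp [this]

theorem appears_subshift {A : Type*} {τ : A → List A} {p : ℕ} (hp : IsConstantLength τ p)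
    (hprim : IsPrimitive τ) (n : ℕ) (a : A) : Appears (iter τ n a) (subshift τ) := by
  obtain ⟨K, u, v, hK, hu, hv⟩ := exists_interior hp hprim a
  obtain ⟨N, hN⟩ := hprim
  have hp1 : 1 ≤ p := by have := hp.1; omega
  -- nested words `W j`, each strictly inside the next
  set W : ℕ → List A := fun j => iter τ (K * j) a with hW
  set o : ℕ → ℕ := fun j => ∑ i ∈ Finset.range j, p ^ (K * i) * u.length with ho
  have hstep : ∀ j, W (j + 1) = (onWord τ)^[K * j] u ++ W j ++ (onWord τ)^[K * j] v := by
    intro j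
    have : W (j + 1) = (onWord τ)^[K * j] (iter τ K a) := by
      rw [iterate_iter]; simp [hW, mul_add]
    rw [this, hK, iterate_append, iterate_append]; rfl
  have hul : 1 ≤ u.length := List.length_pos_iff.2 hu
  have hvl : 1 ≤ v.length := List.length_pos_iff.2 hv
  have hpow : ∀ j, 1 ≤ p ^ (K * j) := fun j => Nat.one_le_pow _ _ hp1
  have hos : ∀ j, o (j + 1) = o j + p ^ (K * j) * u.length := fun j => by
    simp [ho, Finset.sum_range_succ]
  have hoj : ∀ j, j ≤ o j := by
    intro j
    induction j with
    | zero => simp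
    | succ j ih => rw [hos]; nlinarith [hpow j]
  have hlen : ∀ j, o j + j < (W j).length := by
    intro j
    induction j with
    | zero => simp [ho, hW, iter]
    | succ j ih =>
      rw [hstep, hos, List.length_append, List.length_append, length_iterate hp,
        length_iterate hp]
      nlinarith [hpow j]
  have hget1 : ∀ j i : ℕ, i < (W j).length → (W (j + 1))[i + (o (j + 1) - o j)]? = (W j)[i]? := by
    intro j i hi
    have e : i + (o (j + 1) - o j) = ((onWord τ)^[K * j] u).length + i := by
      rw [hos, length_iterate hp]; omega
    rw [hstep, e, List.append_assoc, List.getElem?_append_right (by omega),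
      List.getElem?_append_left (by omega)]
    congr 1; omega
  have hget : ∀ j d i : ℕ, i < (W j).length →
      (W (j + d))[i + (o (j + d) - o j)]? = (W j)[i]? ∧ o j ≤ o (j + d) := by
    intro j d i hi
    induction d with
    | zero => simp
    | succ d ih =>
      obtain ⟨ih, ih'⟩ := ih
      have hlt : i + (o (j + d) - o j) < (W (j + d)).length := by
        rw [List.getElem?_eq_getElem hi] at ih
        exact (List.getElem?_eq_some_iff.1 ih).1
      have h1 := hget1 (j + d) _ hlt
      have h2 := hos (j + d)
      refine ⟨?_, by rw [← add_assoc]; omega⟩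
      rw [← ih, ← h1, ← add_assoc]
      congr 1; omega
  let x : ℤ → A := fun i => ((W i.natAbs)[(i + o i.natAbs).toNat]?).getD a
  have hx : ∀ (j : ℕ) (i : ℤ), i.natAbs ≤ j → (W j)[(i + o j).toNat]? = some (x i) := by
    intro j i hij
    obtain ⟨d, rfl⟩ := Nat.exists_eq_add_of_le hij
    have h0 := hoj i.natAbs
    have h1 := hlen i.natAbs
    have h2 : (i + o i.natAbs).toNat < (W i.natAbs).length := by omega
    obtain ⟨h3, h4⟩ := hget i.natAbs d _ h2
    have h5 : (i + o (i.natAbs + d)).toNat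
        = (i + o i.natAbs).toNat + (o (i.natAbs + d) - o i.natAbs) := by omega
    rw [h5, h3]
    simp only [x]
    rw [List.getElem?_eq_getElem h2]; rfl
  have hword : ∀ (j : ℕ) (k : ℤ) (l : ℕ), (∀ i : ℕ, i < l → (k + i).natAbs ≤ j) → 0 ≤ k + o j →
      word x k l = ((W j).drop (k + o j).toNat).take l := by
    intro j k l h hk
    apply List.ext_getElem?
    intro i
    by_cases hi : i < l
    · have := hx j (k + i) (h i hi)
      have e : (k + i + o j).toNat = (k + o j).toNat + i := by omega
      rw [e] at this
      simp [word, hi, this, List.getElem?_drop]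
    · simp [word, hi]
  have hmem : x ∈ subshift τ := by
    intro k l
    refine ⟨K * (k.natAbs + l), a, ?_⟩
    have := hoj (k.natAbs + l)
    rw [hword (k.natAbs + l) k l (by intro i hi; omega) (by omega)]
    exact (List.take_prefix _ _).isInfix.trans (List.drop_suffix _ _).isInfix
  -- every `W j` occurs in `x`
  have hWx : ∀ j, ∃ k : ℤ, word x k (W j).length = W j := by
    intro j
    refine ⟨-(o j : ℤ), ?_⟩
    apply List.ext_getElem?
    intro i
    by_cases hi : i < (W j).length
    · set d := o j + i
      have h1 := (hget j d i hi).1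
      have h2 := (hget j d i hi).2
      have h3 := hx (j + d) (-(o j : ℤ) + i) (by omega)
      have e : (-(o j : ℤ) + i + o (j + d)).toNat = i + (o (j + d) - o j) := by omega
      rw [e, h1] at h3
      rw [h3]; simp [word, hi]
    · simp [word, hi]
  have hK1 : 1 ≤ K := by
    rcases Nat.eq_zero_or_pos K with rfl | h
    · have := congrArg List.length hK
      simp [iter] at this; omega
    · exact h
  obtain ⟨d, hd⟩ : ∃ d, K * (N + n) = n + N + d :=
    Nat.exists_eq_add_of_le (by nlinarith)
  have hne : iter τ d a ≠ [] := by
    apply List.ne_nil_of_length_pos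
    rw [iter, length_iterate hp]; simp; exact Nat.pow_pos (by omega)
  obtain ⟨b, hb⟩ := List.exists_mem_of_ne_nil _ hne
  have hin : iter τ n a <:+: W (N + n) := by
    have h1 : iter τ n a <:+: iter τ (n + N) b := iter_infix τ (hN a b)
    have h2 : iter τ (n + N) b <:+: iter τ (n + N + d) a := iter_infix τ hb
    simp only [hW]; rw [hd]; exact h1.trans h2
  obtain ⟨s, t, hst⟩ := hin
  obtain ⟨k, hk⟩ := hWx (N + n)
  refine ⟨x, hmem, k + s.length, ?_⟩
  apply List.ext_getElem?
  intro i
  by_cases hi : i < (iter τ n a).length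
  · have h1 := congrArg (fun l => l[s.length + i]?) hk
    have hl : s.length + i < (W (N + n)).length := by
      rw [← hst]; simp; omega
    simp only [word, List.getElem?_ofFn, hl, dite_true] at h1
    rw [← hst, List.append_assoc, List.getElem?_append_right (by omega),
      List.getElem?_append_left (by omega)] at h1
    simp only [Nat.add_sub_cancel_left] at h1
    rw [← h1]
    simp [word, hi, add_assoc]
  · simp [word, hi]

theorem shift_zpow_apply {A : Type*} (n : ℤ) (x : ℤ → A) (i : ℤ) :
    (shift ^ n) x i = x (i + n) := by
  induction n generalizing x i with
  | zero => simp
  | succ n ih => rw [zpow_add_one, Equiv.Perm.mul_apply, ih]; simp [shift, add_assoc]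
  | pred n ih =>
    rw [zpow_sub_one, Equiv.Perm.mul_apply, ih]
    simp only [Equiv.Perm.inv_def, shift, Equiv.coe_fn_symm_mk]
    congr 1; ring

theorem word_shift {A : Type*} (x : ℤ → A) (k n : ℤ) (l : ℕ) :
    word ((shift ^ n) x) k l = word x (k + n) l := by
  unfold word; congr 1; funext i; rw [shift_zpow_apply]; congr 1; ring

theorem shift_zpow_mem {A : Type*} {S : Set (ℤ → A)} (hS : shift '' S = S) (n : ℤ) {x : ℤ → A}
    (hx : x ∈ S) : (shift ^ n) x ∈ S := by
  induction n generalizing x with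
  | zero => simpa using hx
  | succ n ih =>
    rw [zpow_add_one, Equiv.Perm.mul_apply]
    exact ih (hS ▸ Set.mem_image_of_mem _ hx)
  | pred n ih =>
    rw [zpow_sub_one, Equiv.Perm.mul_apply]
    refine ih ?_
    rw [← hS] at hx
    obtain ⟨y, hy, rfl⟩ := hx
    simpa using hy

theorem isSubshift_subshift {A : Type*} (τ : A → List A) : IsSubshift (subshift τ) := by
  let _ : TopologicalSpace A := ⊥
  have : DiscreteTopology A := ⟨rfl⟩
  constructor
  · change IsClosed (subshift τ)
    have : subshift τ = ⋂ (k : ℤ) (n : ℕ), (fun x : ℤ → A => fun i : Fin n => x (k + (i : ℕ))) ⁻¹'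
        {f | ∃ (m : ℕ) (a : A), List.ofFn f <:+: iter τ m a} := by
      ext x; simp [subshift, word]
    rw [this]
    refine isClosed_iInter fun k => isClosed_iInter fun n => ?_
    exact (isClosed_discrete _).preimage (by fun_prop)
  · ext x
    constructor
    · rintro ⟨y, hy, rfl⟩ k n
      have := word_shift y k 1 n
      rw [zpow_one] at this
      rw [this]; exact hy _ _
    · intro hx
      refine ⟨(shift ^ (-1 : ℤ)) x, fun k n => ?_, by simp⟩
      rw [word_shift]; exact hx _ _

/-- For a primitive substitution of constant length, `X_τ` is the smallest subshift in which all
the words `τⁿ(a)` appear. -/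
theorem isLeast_subshift {A : Type*} {τ : A → List A} {p : ℕ} (hp : IsConstantLength τ p)
    (hprim : IsPrimitive τ) :
    IsLeast {S : Set (ℤ → A) | IsSubshift S ∧ ∀ (n : ℕ) (a : A), Appears (iter τ n a) S}
      (subshift τ) := by
  refine ⟨⟨isSubshift_subshift τ, appears_subshift hp hprim⟩, ?_⟩
  rintro S ⟨⟨hcl, hsh⟩, happ⟩ x hx
  let _ : TopologicalSpace A := ⊥
  have : DiscreteTopology A := ⟨rfl⟩
  have key : ∀ N : ℕ, ∃ y ∈ S, ∀ i : ℤ, i.natAbs ≤ N → y i = x i := by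
    intro N
    obtain ⟨m, a, s, t, hst⟩ := hx (-(N : ℤ)) (2 * N + 1)
    obtain ⟨y, hy, k, hk⟩ := happ m a
    refine ⟨(shift ^ (k + s.length + N)) y, shift_zpow_mem hsh _ hy, fun i hi => ?_⟩
    rw [shift_zpow_apply]
    have hlw : (word x (-(N : ℤ)) (2 * N + 1)).length = 2 * N + 1 := by simp [word]
    set j := (i + N).toNat with hj
    have hjN : j < 2 * N + 1 := by omega
    have hl : s.length + j < (iter τ m a).length := by
      rw [← hst]; simp [hlw]; omega
    have h1 := congrArg (fun l => l[s.length + j]?) hk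
    simp only [word, List.getElem?_ofFn, hl, dite_true] at h1
    rw [← hst, List.append_assoc, List.getElem?_append_right (by omega),
      List.getElem?_append_left (by omega)] at h1
    simp only [Nat.add_sub_cancel_left, word, List.getElem?_ofFn, hjN, dite_true,
      Option.some.injEq] at h1
    convert h1 using 2 <;> push_cast <;> omega
  choose y hyS hy using key
  refine IsClosed.mem_of_tendsto (f := y) (b := atTop) hcl ?_ (Eventually.of_forall hyS)
  rw [tendsto_pi_nhds]
  intro i
  apply tendsto_const_nhds.congr'
  filter_upwards [eventually_ge_atTop i.natAbs] with N hN using (hy N i hN).symm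

end Substitution

/-! The engine is recognizability: the pieces `Tᵏ τⁿ(X)`, `0 ≤ k < pⁿ`, cover `X` and are disjoint
(`exists_translate_inflate`, `eq_of_translate_inflate_eq`). So every point has an address, the
sequence of base-`p` digits locating the origin in the nested `τⁿ`-blocks around it. Disjointness
comes from `pow_dvd_of_translate_inflate`: if the return times of `τⁿ(X)` were generated by a proper
divisor `d` of `pⁿ`, conjugating `Tᵈ` by `τⁿ` would give a root of the shift of order `pⁿ / d`. This
root has a two-letter local rule, so only finitely many orders occur, and a stable order must be
coprime to `p`, hence `1`.

Sufficiency. Given positions `i < j` at which `τᵐ(a)` and `τᵐ(b)` both reproduce `a` and `b`, and a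
coincidence at some `k > i`, any address with digits in `{i, j}` is realised by a point built around
`a` and one built around `b`. Whenever the digit is `i`, a copy of the pair `(a, b)` and a long
common block lie to the right, so if this happens infinitely often the pair is Li–Yorke. There are
uncountably many such addresses, and the points remember them.

Necessity. A Li–Yorke pair is proximal, so its points have the same address and can be desubstituted
together forever (`exists_tower`). Some pair of letters `(a, b)` recurs at the origin. If the digits
are not eventually `p - 1`, the blocks around the origin eventually contain a coincidence to its
right. Two pairs sharing `(a, b)` and the letters at some later level, but with different digits
just below it, would then give two return paths to `(a, b)`, one to the right of the other;
composing them in the two orders produces the coincidence condition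
(`coincidenceCondition_of_cycles`). Without that condition the letters therefore determine the
digits going down, and a pigeonhole over finitely many states leaves finitely many orbits. -/

namespace Substitution

open Filter

variable {A : Type*} {τ : A → List A} {p : ℕ}

/-! ### Letters of iterates and the action of `τⁿ` on sequences -/

/-- The letter at position `j` of `τⁿ(a)`. -/
def col (τ : A → List A) (n : ℕ) (a : A) (j : ℕ) : A := (iter τ n a).getD j a

/-- The substitution `τⁿ` of constant length `pⁿ`, acting on two-sided sequences. -/
def inflate (τ : A → List A) (p n : ℕ) (x : ℤ → A) : ℤ → A :=
  fun i => col τ n (x (i / (p ^ n : ℕ))) (i % (p ^ n : ℕ)).toNat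

/-- The shift by `e` places. -/
def translate (e : ℤ) (x : ℤ → A) : ℤ → A := fun i => x (i + e)

theorem translate_apply (e : ℤ) (x : ℤ → A) (i : ℤ) : translate e x i = x (i + e) := rfl

theorem translate_translate (e f : ℤ) (x : ℤ → A) :
    translate e (translate f x) = translate (e + f) x := by
  funext i; simp [translate, add_assoc]

@[simp] theorem translate_zero (x : ℤ → A) : translate 0 x = x := by
  funext i; simp [translate]

theorem shift_zpow_eq (e : ℤ) (x : ℤ → A) : (shift ^ e) x = translate e x := by
  funext i; rw [shift_zpow_apply]; rfl

theorem length_iter (hp : IsConstantLength τ p) (n : ℕ) (a : A) :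
    (iter τ n a).length = p ^ n := by
  rw [iter, length_iterate hp]; simp

theorem IsConstantLength.pos (hp : IsConstantLength τ p) : 0 < p := by have := hp.1; omega

theorem IsConstantLength.pow_pos (hp : IsConstantLength τ p) (n : ℕ) : 0 < p ^ n :=
  Nat.pow_pos hp.pos

theorem getElem?_iter (hp : IsConstantLength τ p) {n j : ℕ} (hj : j < p ^ n) (a : A) :
    (iter τ n a)[j]? = some (col τ n a j) := by
  have : j < (iter τ n a).length := by rwa [length_iter hp]
  simp [col, this]

theorem iter_zero (a : A) : iter τ 0 a = [a] := rfl

theorem iter_one (a : A) : iter τ 1 a = τ a := by simp [iter, onWord]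

theorem col_add (hp : IsConstantLength τ p) {m n i j : ℕ} (hi : i < p ^ n) (hj : j < p ^ m)
    (a : A) : col τ (m + n) a (i * p ^ m + j) = col τ m (col τ n a i) j := by
  have hi' : i < (iter τ n a).length := by rwa [length_iter hp]
  have h1 : iter τ n a = (iter τ n a).take i ++ ([col τ n a i] ++ (iter τ n a).drop (i + 1)) := by
    have := getElem?_iter hp hi a
    rw [List.getElem?_eq_some_iff] at this
    obtain ⟨h, h2⟩ := this
    rw [← h2]; simp
  have h2 : ((onWord τ)^[m] ((iter τ n a).take i)).length = i * p ^ m := by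
    rw [length_iterate hp, List.length_take, min_eq_left hi'.le, mul_comm]
  have h3 : i * p ^ m + j < p ^ (m + n) := by
    rw [pow_add]
    calc i * p ^ m + j < (i + 1) * p ^ m := by rw [add_mul]; omega
      _ ≤ p ^ n * p ^ m := Nat.mul_le_mul_right _ hi
      _ = _ := mul_comm _ _
  have h4 := getElem?_iter hp h3 a
  rw [← iterate_iter, h1, iterate_append, iterate_append,
    List.getElem?_append_right (by omega), h2, Nat.add_sub_cancel_left,
    List.getElem?_append_left (by rw [length_iterate hp]; simpa using hj)] at h4
  have h5 := getElem?_iter hp hj (col τ n a i)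
  rw [iter, h4] at h5
  exact Option.some.inj h5

theorem col_mem (hp : IsConstantLength τ p) {n j : ℕ} (hj : j < p ^ n) (a : A) :
    col τ n a j ∈ iter τ n a := List.mem_of_getElem? (getElem?_iter hp hj a)

theorem col_zero (a : A) : col τ 0 a 0 = a := rfl

/-- Read `τⁿ⁺¹(a)` as `τⁿ` applied to the letters of `τ(a)`: induction recovers these letters, and
injectivity of `τ` then recovers `a`. -/
theorem eq_of_col_eq (hp : IsConstantLength τ p) (hinj : Function.Injective τ) {n : ℕ} {a b : A}
    (h : ∀ j < p ^ n, col τ n a j = col τ n b j) : a = b := by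
  induction n generalizing a b with
  | zero => exact h 0 (by simp)
  | succ n ih =>
    apply hinj
    rw [← iter_one (τ := τ) a, ← iter_one (τ := τ) b]
    apply List.ext_getElem?
    intro i
    by_cases hi : i < p ^ 1
    · rw [getElem?_iter hp hi, getElem?_iter hp hi]
      congr 1
      apply ih
      intro j hj
      rw [← col_add hp hi hj, ← col_add hp hi hj]
      apply h
      rw [pow_one] at hi
      calc i * p ^ n + j < (i + 1) * p ^ n := by rw [add_mul]; omega
        _ ≤ p * p ^ n := Nat.mul_le_mul_right _ hi
        _ = _ := by ring
    · rw [List.getElem?_eq_none (by rw [length_iter hp]; omega),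
        List.getElem?_eq_none (by rw [length_iter hp]; omega)]

theorem inflate_apply (hp : IsConstantLength τ p) {n j : ℕ} (hj : j < p ^ n) (x : ℤ → A) (t : ℤ) :
    inflate τ p n x ((p ^ n : ℕ) * t + j) = col τ n (x t) j := by
  have h0 : ((p ^ n : ℕ) : ℤ) ≠ 0 := by exact_mod_cast (hp.pow_pos n).ne'
  have h1 : (j : ℤ) / (p ^ n : ℕ) = 0 := Int.ediv_eq_zero_of_lt (by omega) (by exact_mod_cast hj)
  have h2 : (j : ℤ) % (p ^ n : ℕ) = j := Int.emod_eq_of_lt (by omega) (by exact_mod_cast hj)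
  unfold inflate
  rw [Int.mul_add_ediv_left _ _ h0, Int.mul_add_emod_self_left, h1, h2]
  simp

/-- Every integer is `pⁿ t + j` with `0 ≤ j < pⁿ`. -/
theorem exists_block (hp : IsConstantLength τ p) (n : ℕ) (i : ℤ) :
    ∃ (t : ℤ) (j : ℕ), j < p ^ n ∧ i = (p ^ n : ℕ) * t + j := by
  have h0 : (0 : ℤ) < (p ^ n : ℕ) := by exact_mod_cast hp.pow_pos n
  refine ⟨i / (p ^ n : ℕ), (i % (p ^ n : ℕ)).toNat, ?_, ?_⟩
  · have := Int.emod_lt_of_pos i h0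
    have := Int.emod_nonneg i h0.ne'
    omega
  · have := Int.emod_nonneg i h0.ne'
    rw [Int.toNat_of_nonneg this, Int.mul_ediv_add_emod]

theorem inflate_ext (hp : IsConstantLength τ p) {n : ℕ} {x y : ℤ → A}
    (h : ∀ (t : ℤ), ∀ j < p ^ n, col τ n (x t) j = y ((p ^ n : ℕ) * t + j)) :
    inflate τ p n x = y := by
  funext i
  obtain ⟨t, j, hj, rfl⟩ := exists_block hp n i
  rw [inflate_apply hp hj, h t j hj]

theorem inflate_zero (hp : IsConstantLength τ p) (x : ℤ → A) : inflate τ p 0 x = x := by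
  apply inflate_ext hp
  intro t j hj
  have : j = 0 := by simpa using hj
  subst this
  simp [col_zero]

theorem inflate_add (hp : IsConstantLength τ p) (m n : ℕ) (x : ℤ → A) :
    inflate τ p m (inflate τ p n x) = inflate τ p (m + n) x := by
  symm
  apply inflate_ext hp
  intro t j hj
  have h0 := hp.pow_pos m
  have h1 : j / p ^ m < p ^ n := by
    rw [Nat.div_lt_iff_lt_mul h0, ← pow_add, add_comm]; exact hj
  have h2 := Nat.mod_lt j h0
  have h3 : ((p ^ (m + n) : ℕ) : ℤ) * t + j
      = (p ^ m : ℕ) * ((p ^ n : ℕ) * t + (j / p ^ m : ℕ)) + (j % p ^ m : ℕ) := by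
    have := Nat.div_add_mod j (p ^ m)
    have h4 : (j : ℤ) = (p ^ m : ℕ) * (j / p ^ m : ℕ) + (j % p ^ m : ℕ) := by exact_mod_cast this.symm
    rw [pow_add]; push_cast at h4 ⊢
    linear_combination h4
  rw [h3, inflate_apply hp h2, inflate_apply hp h1, ← col_add hp h1 h2,
    mul_comm, Nat.div_add_mod]

theorem translate_inflate (hp : IsConstantLength τ p) (n : ℕ) (e : ℤ) (x : ℤ → A) :
    translate ((p ^ n : ℕ) * e) (inflate τ p n x) = inflate τ p n (translate e x) := by
  symm
  apply inflate_ext hp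
  intro t j hj
  rw [translate_apply, translate_apply, ← inflate_apply hp hj]
  congr 1; ring

theorem inflate_injective (hp : IsConstantLength τ p) (hinj : Function.Injective τ) (n : ℕ) :
    Function.Injective (inflate τ p n) := by
  intro x y h
  funext t
  apply eq_of_col_eq hp hinj (n := n)
  intro j hj
  rw [← inflate_apply hp hj, ← inflate_apply hp hj, h]

theorem inflate_nonneg_lt (hp : IsConstantLength τ p) {n : ℕ} {i : ℕ} (hi : i < p ^ n)
    (x : ℤ → A) : inflate τ p n x i = col τ n (x 0) i := by
  have := inflate_apply hp hi x 0
  simpa using this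

/-- `inflate n x` on the two blocks `[0, 2pⁿ)` depends only on `x 0` and `x 1`. -/
theorem inflate_congr (hp : IsConstantLength τ p) {n : ℕ} {x y : ℤ → A} {s t : ℤ}
    (h0 : x s = y t) (h1 : x (s + 1) = y (t + 1)) {i : ℕ} (hi : i < 2 * p ^ n) :
    inflate τ p n x ((p ^ n : ℕ) * s + i) = inflate τ p n y ((p ^ n : ℕ) * t + i) := by
  by_cases h : i < p ^ n
  · rw [inflate_apply hp h, inflate_apply hp h, h0]
  · obtain ⟨k, rfl⟩ := Nat.exists_eq_add_of_le (not_lt.1 h)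
    have hk : k < p ^ n := by omega
    have e : ∀ s : ℤ, ((p ^ n : ℕ) : ℤ) * s + ((p ^ n + k : ℕ) : ℤ)
        = (p ^ n : ℕ) * (s + 1) + k := by intro s; push_cast; ring
    rw [e, e, inflate_apply hp hk, inflate_apply hp hk, h1]

/-! ### Occurrences of words, and invariance of `X_τ` under `τ` -/

theorem word_eq_iff {x : ℤ → A} {k : ℤ} {w : List A} :
    word x k w.length = w ↔ ∀ (j : ℕ) (c : A), w[j]? = some c → x (k + j) = c := by
  constructor
  · intro h j c hj
    have hl : j < w.length := (List.getElem?_eq_some_iff.1 hj).1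
    rw [← h] at hj
    simpa [word, hl] using hj
  · intro h
    apply List.ext_getElem?
    intro j
    by_cases hj : j < w.length
    · rw [List.getElem?_eq_getElem hj]
      simp [word, hj, h j _ (List.getElem?_eq_getElem hj)]
    · simp [word, hj]

theorem word_iter_iff (hp : IsConstantLength τ p) {x : ℤ → A} {k : ℤ} {n : ℕ} {a : A} :
    word x k (iter τ n a).length = iter τ n a ↔ ∀ j < p ^ n, x (k + j) = col τ n a j := by
  rw [word_eq_iff]
  constructor
  · intro h j hj
    exact h j _ (getElem?_iter hp hj a)
  · intro h j c hj
    have hj' : j < p ^ n := by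
      rw [← length_iter hp n a]; exact (List.getElem?_eq_some_iff.1 hj).1
    rw [getElem?_iter hp hj'] at hj
    rw [h j hj']; exact Option.some.inj hj

theorem Appears.of_infix {v w : List A} {S : Set (ℤ → A)} (h : Appears w S) (hv : v <:+: w) :
    Appears v S := by
  obtain ⟨x, hx, k, hk⟩ := h
  obtain ⟨s, t, rfl⟩ := hv
  refine ⟨x, hx, k + s.length, ?_⟩
  rw [word_eq_iff] at hk ⊢
  intro j c hj
  have hl : j < v.length := (List.getElem?_eq_some_iff.1 hj).1
  have := hk (s.length + j) c (by
    rw [List.append_assoc, List.getElem?_append_right (by omega),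
      List.getElem?_append_left (by omega), Nat.add_sub_cancel_left, hj])
  rw [← this]; congr 1; push_cast; ring

theorem word_infix_word (x : ℤ → A) {k l : ℤ} {m n : ℕ} (h1 : l ≤ k) (h2 : k + m ≤ l + n) :
    word x k m <:+: word x l n := by
  have : word x k m = ((word x l n).drop (k - l).toNat).take m := by
    apply List.ext_getElem?
    intro j
    by_cases hj : j < m
    · have h3 : (k - l).toNat + j < n := by omega
      have h4 : l + (max (k - l) 0 + j) = k + j := by omega
      simp [word, hj, h3, List.getElem?_drop, h4]
    · simp [word, hj]
  rw [this]
  exact (List.take_prefix _ _).isInfix.trans (List.drop_suffix _ _).isInfix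

theorem infix_onWord {u v : List A} (h : u <:+: v) : onWord τ u <:+: onWord τ v := by
  obtain ⟨s, t, rfl⟩ := h
  exact ⟨onWord τ s, onWord τ t, by simp [onWord]⟩

theorem translate_mem {x : ℤ → A} (hx : x ∈ subshift τ) (e : ℤ) :
    translate e x ∈ subshift τ := by
  rw [← shift_zpow_eq]
  exact shift_zpow_mem (isSubshift_subshift τ).2 e hx

theorem word_inflate_one (hp : IsConstantLength τ p) (x : ℤ → A) (k : ℤ) (l : ℕ) :
    word (inflate τ p 1 x) (p * k) (p * l) = onWord τ (word x k l) := by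
  induction l generalizing k with
  | zero => simp [word, onWord]
  | succ l ih =>
    have h1 : word x k (l + 1) = x k :: word x (k + 1) l := by
      simp only [word, List.ofFn_succ]
      congr 1
      · simp
      · congr 1; funext i; congr 1; simp; ring
    have h2 : onWord τ (word x k (l + 1)) = τ (x k) ++ onWord τ (word x (k + 1) l) := by
      rw [h1]; simp [onWord]
    rw [h2, ← ih (k + 1)]
    apply List.ext_getElem?
    intro j
    have hlen : (τ (x k)).length = p := hp.2 _
    by_cases hj : j < p
    · rw [List.getElem?_append_left (by omega)]
      have h3 : j < p ^ 1 := by simpa using hj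
      have h4 := getElem?_iter hp h3 (x k)
      rw [iter_one] at h4
      have h5 : j < p * (l + 1) := by nlinarith
      have h6 := inflate_apply hp h3 x k
      rw [pow_one] at h6
      simp [word, h5, h4, h6]
    · rw [List.getElem?_append_right (by omega), hlen]
      by_cases h5 : j < p * (l + 1)
      · have h6 : j - p < p * l := by rw [mul_add] at h5; omega
        have h7 : (p : ℤ) * (k + 1) + ((j - p : ℕ) : ℤ) = p * k + j := by
          push_cast [Nat.cast_sub (not_lt.1 hj)]; ring
        simp [word, h5, h6, h7]
      · have h6 : ¬ j - p < p * l := by rw [mul_add] at h5; omega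
        simp [word, h5, h6]

theorem inflate_mem (hp : IsConstantLength τ p) {x : ℤ → A} (hx : x ∈ subshift τ) (n : ℕ) :
    inflate τ p n x ∈ subshift τ := by
  induction n with
  | zero => rwa [inflate_zero hp]
  | succ n ih =>
    rw [add_comm, ← inflate_add hp]
    generalize inflate τ p n x = y at ih
    intro k l
    obtain ⟨t, j, hj, hk⟩ := exists_block hp 1 k
    rw [pow_one] at hj hk
    -- A word of length `l` starting inside block `t` meets at most `l + 1` blocks.
    obtain ⟨m, a, hma⟩ := ih t (l + 1)
    refine ⟨m + 1, a, ?_⟩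
    have h1 : iter τ (m + 1) a = onWord τ (iter τ m a) := by
      simp only [iter, Function.iterate_succ_apply']
    rw [h1]
    refine List.IsInfix.trans ?_ (infix_onWord hma)
    rw [← word_inflate_one hp]
    apply word_infix_word
    · omega
    · have := hp.1
      push_cast
      nlinarith

theorem exists_mem_iter_one (hp : IsConstantLength τ p) (hprim : IsPrimitive τ) (a : A) :
    ∃ b, a ∈ iter τ 1 b := by
  obtain ⟨N, hN⟩ := hprim
  cases N with
  -- Primitivity with exponent `0` forces a one-letter alphabet, so `a` occurs in `τ(a)`.
  | zero =>
    refine ⟨a, ?_⟩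
    have h := col_mem hp (n := 1) (j := 0) (hp.pow_pos 1) a
    have h2 := hN (col τ 1 a 0) a
    rw [iter_zero, List.mem_singleton] at h2
    rwa [h2] at h
  | succ N =>
    have h := hN a a
    have h1 : iter τ (N + 1) a = onWord τ (iter τ N a) := by
      simp only [iter, Function.iterate_succ_apply']
    rw [h1, onWord, List.mem_flatMap] at h
    obtain ⟨b, -, hb⟩ := h
    exact ⟨b, by rwa [iter_one]⟩

/-! ### The coincidence condition by positions -/

/-- The coincidence condition in terms of positions. -/
theorem coincidenceCondition_iff (hp : IsConstantLength τ p) :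
    CoincidenceCondition τ ↔ ∃ (m : ℕ) (a b : A), a ≠ b ∧ ∃ i j k : ℕ, i < j ∧ i < k ∧
      j < p ^ m ∧ k < p ^ m ∧ col τ m a i = a ∧ col τ m b i = b ∧ col τ m a j = a ∧
      col τ m b j = b ∧ col τ m a k = col τ m b k := by
  constructor
  · rintro ⟨m, a, b, hab, u, v, w, u', v', w', h1, h2, hu, hv, hw, -, l, c, h3, h4⟩
    have hla := length_iter hp m a
    rw [h1] at hla
    simp only [List.length_append, List.length_singleton] at hla
    have hl : l < (v ++ [a] ++ w).length := (List.getElem?_eq_some_iff.1 h3).1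
    simp only [List.length_append, List.length_singleton] at hl
    have ga : ∀ {i : ℕ} {c : A}, i < p ^ m → (u ++ [a] ++ v ++ [a] ++ w)[i]? = some c →
        col τ m a i = c := by
      intro i c hi h
      rw [← h1, getElem?_iter hp hi] at h
      exact Option.some.inj h
    have gb : ∀ {i : ℕ} {c : A}, i < p ^ m → (u' ++ [b] ++ v' ++ [b] ++ w')[i]? = some c →
        col τ m b i = c := by
      intro i c hi h
      rw [← h2, getElem?_iter hp hi] at h
      exact Option.some.inj h
    -- The words `v a w` and `v' b w'` start right after the first marked letter, so their
    -- coordinate `l` is position `|u| + 1 + l` of the iterates.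
    refine ⟨m, a, b, hab, u.length, u.length + 1 + v.length, u.length + 1 + l, by omega, by omega,
      by omega, by omega, ga (by omega) (by simp), gb (by omega) (by rw [hu]; simp),
      ga (by omega) ?_, gb (by omega) ?_, ?_⟩
    · simp [add_assoc, Nat.add_comm 1]
    · rw [hu, hv]
      simp [add_assoc, Nat.add_comm 1]
    · rw [ga (by omega) (c := c), gb (by omega) (c := c)]
      · rw [← h4, hu]
        simp [add_assoc, List.getElem?_append_right, Nat.add_comm 1]
      · rw [← h3]
        simp [add_assoc, List.getElem?_append_right, Nat.add_comm 1]
  · rintro ⟨m, a, b, hab, i, j, k, hij, hik, hj, hk, hai, hbi, haj, hbj, hc⟩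
    have dec : ∀ (l : List A) (a : A), l[i]? = some a → l[j]? = some a →
        l = l.take i ++ [a] ++ (l.drop (i + 1)).take (j - i - 1) ++ [a] ++ l.drop (j + 1) := by
      intro l a h1 h2
      obtain ⟨hi', h1⟩ := List.getElem?_eq_some_iff.1 h1
      obtain ⟨hj', h2⟩ := List.getElem?_eq_some_iff.1 h2
      have e1 : l.drop (i + 1) = (l.drop (i + 1)).take (j - i - 1) ++ [a] ++ l.drop (j + 1) := by
        conv_lhs => rw [← List.take_append_drop (j - i - 1) (l.drop (i + 1))]
        rw [List.drop_drop, show i + 1 + (j - i - 1) = j by omega, List.drop_eq_getElem_cons hj', h2]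
        simp
      conv_lhs => rw [← List.take_append_drop i l, List.drop_eq_getElem_cons hi', h1, e1]
      simp
    have hla := length_iter hp m a
    have hlb := length_iter hp m b
    have ea := dec _ a ((getElem?_iter hp (by omega) a).trans (by rw [hai]))
      ((getElem?_iter hp hj a).trans (by rw [haj]))
    have eb := dec _ b ((getElem?_iter hp (by omega) b).trans (by rw [hbi]))
      ((getElem?_iter hp hj b).trans (by rw [hbj]))
    have tail : ∀ (l : List A) (a : A), l[j]? = some a →
        (l.drop (i + 1)).take (j - i - 1) ++ [a] ++ l.drop (j + 1) = l.drop (i + 1) := by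
      intro l a h2
      obtain ⟨hj', h2⟩ := List.getElem?_eq_some_iff.1 h2
      conv_rhs => rw [← List.take_append_drop (j - i - 1) (l.drop (i + 1))]
      rw [List.drop_drop, show i + 1 + (j - i - 1) = j by omega, List.drop_eq_getElem_cons hj', h2]
      simp
    refine ⟨m, a, b, hab, _, _, _, _, _, _, ea, eb, ?_, ?_, ?_, ?_⟩
    · simp [hla, hlb]
    · simp [hla, hlb]
    · simp [hla, hlb]
    · rw [tail _ a ((getElem?_iter hp hj a).trans (by rw [haj])),
        tail _ b ((getElem?_iter hp hj b).trans (by rw [hbj]))]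
      refine ⟨by simp [hla, hlb], k - i - 1, col τ m a k, ?_, ?_⟩
      · rw [List.getElem?_drop, show i + 1 + (k - i - 1) = k by omega, getElem?_iter hp hk]
      · rw [List.getElem?_drop, show i + 1 + (k - i - 1) = k by omega, getElem?_iter hp hk, hc]

/-! ### Block codes and periods -/

/-- The sliding block code with the local rule `f` on two letters. -/
def blockCode (f : A → A → A) (x : ℤ → A) : ℤ → A := fun t => f (x t) (x (t + 1))

/-- An infinite `X_τ` has no common period. -/
theorem not_forall_periodic [Finite A] (hinf : (subshift τ).Infinite) {r : ℕ} (hr : 0 < r)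
    (h : ∀ x ∈ subshift τ, translate r x = x) : False := by
  apply hinf
  apply Set.Finite.of_finite_image (f := fun x : ℤ → A => fun i : Fin r => x (i : ℕ))
  · exact Set.toFinite _
  · have hper : ∀ x ∈ subshift τ, ∀ (t : ℤ) (j : ℤ), x (r * t + j) = x j := by
      intro x hx t j
      induction t with
      | zero => simp
      | succ t ih =>
        rw [← ih]
        conv_rhs => rw [← h x hx, translate_apply]
        congr 1; ring
      | pred t ih =>
        rw [← ih]
        conv_lhs => rw [← h x hx, translate_apply]
        congr 1; ring
    intro x hx y hy hxy
    funext i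
    have h0 : (0 : ℤ) < r := by exact_mod_cast hr
    have h1 := Int.emod_nonneg i h0.ne'
    have h2 := Int.emod_lt_of_pos i h0
    rw [← Int.mul_ediv_add_emod i r, hper x hx, hper y hy]
    have := congrFun hxy ⟨(i % r).toNat, by omega⟩
    simpa [Int.toNat_of_nonneg h1] using this

/-- Used with `e * k` a multiple of `pⁿ`, where it exhibits the block code as a root of a power of
the shift. -/
theorem iterate_blockCode {n e : ℕ} {f : A → A → A}
    (hf : ∀ x ∈ subshift τ, blockCode f x ∈ subshift τ ∧
      translate e (inflate τ p n x) = inflate τ p n (blockCode f x)) (k : ℕ) {x : ℤ → A}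
    (hx : x ∈ subshift τ) : (blockCode f)^[k] x ∈ subshift τ ∧
      translate ((e * k : ℕ) : ℤ) (inflate τ p n x) = inflate τ p n ((blockCode f)^[k] x) := by
  induction k with
  | zero => exact ⟨hx, by simp⟩
  | succ k ih =>
    rw [Function.iterate_succ_apply']
    refine ⟨(hf _ ih.1).1, ?_⟩
    rw [← (hf _ ih.1).2, ← ih.2, translate_translate]
    congr 1; push_cast; ring

theorem continuous_translate [TopologicalSpace A] (e : ℤ) : Continuous (translate e : (ℤ → A) → ℤ → A) :=
  continuous_pi fun i => continuous_apply (i + e)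

/-! ### Minimality and recognizability -/

section Topology

variable [TopologicalSpace A] [DiscreteTopology A]

theorem continuous_inflate (n : ℕ) : Continuous (inflate τ p n) :=
  continuous_pi fun i =>
    (continuous_of_discreteTopology (f := fun a => col τ n a (i % (p ^ n : ℕ)).toNat)).comp
      (continuous_apply (i / (p ^ n : ℕ)))

theorem isClosed_subshift : IsClosed (subshift τ) := by
  have h := (isSubshift_subshift τ).1
  rw [← DiscreteTopology.eq_bot (α := A)] at h
  exact h

theorem isSubshift_of_translate {S : Set (ℤ → A)} (hcl : IsClosed S)
    (htr : ∀ e, ∀ x ∈ S, translate e x ∈ S) : IsSubshift S := by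
  constructor
  · rw [← DiscreteTopology.eq_bot (α := A)]; exact hcl
  · ext x
    constructor
    · rintro ⟨y, hy, rfl⟩
      exact htr 1 y hy
    · intro hx
      refine ⟨translate (-1) x, htr _ _ hx, ?_⟩
      funext i; simp [shift, translate]

variable [Finite A]

theorem isCompact_subshift : IsCompact (subshift τ) := isClosed_subshift.isCompact

/-- The union of the `p` compact sets `Tᵏ τ(X)` is closed and shift-invariant and contains every
`τⁿ(a)`, so it contains `X`, the least subshift with this property. -/
theorem exists_translate_inflate_one (hp : IsConstantLength τ p) (hprim : IsPrimitive τ)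
    {x : ℤ → A} (hx : x ∈ subshift τ) :
    ∃ k < p, ∃ y ∈ subshift τ, x = translate k (inflate τ p 1 y) := by
  set S : Set (ℤ → A) :=
    ⋃ k ∈ Set.Iio p, (fun y => translate (k : ℤ) (inflate τ p 1 y)) '' subshift τ with hS
  have hcl : IsClosed S := by
    refine (Set.finite_Iio p).isClosed_biUnion fun k _ => ?_
    exact (isCompact_subshift.image
      ((continuous_translate _).comp (continuous_inflate 1))).isClosed
  have hmem : ∀ (e : ℤ), ∀ y ∈ subshift τ, translate e (inflate τ p 1 y) ∈ S := by
    intro e y hy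
    obtain ⟨t, j, hj, rfl⟩ := exists_block hp 1 e
    simp only [hS, Set.mem_iUnion]
    refine ⟨j, by simpa using hj, translate t y, translate_mem hy t, ?_⟩
    simp only
    rw [← translate_inflate hp, translate_translate, add_comm]
  have htr : ∀ e, ∀ x ∈ S, translate e x ∈ S := by
    intro e x hx
    simp only [hS, Set.mem_iUnion] at hx
    obtain ⟨k, -, y, hy, rfl⟩ := hx
    simp only
    rw [translate_translate]
    exact hmem _ _ hy
  have happ1 : ∀ (n : ℕ) (a : A), Appears (iter τ (1 + n) a) S := by
    intro n a
    obtain ⟨y, hy, k, hk⟩ := appears_subshift hp hprim n a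
    rw [word_iter_iff hp] at hk
    refine ⟨inflate τ p 1 y, by simpa using hmem 0 y hy, (p ^ 1 : ℕ) * k, ?_⟩
    rw [word_iter_iff hp]
    intro j hj
    have h0 := hp.pow_pos 1
    have h1 : j / p ^ 1 < p ^ n := by
      rw [Nat.div_lt_iff_lt_mul h0, ← pow_add, add_comm]; exact hj
    have h2 := Nat.mod_lt j h0
    have h3 : ((p ^ 1 : ℕ) : ℤ) * k + j
        = (p ^ 1 : ℕ) * (k + (j / p ^ 1 : ℕ)) + (j % p ^ 1 : ℕ) := by
      have := Nat.div_add_mod j (p ^ 1)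
      have h4 : (j : ℤ) = (p ^ 1 : ℕ) * (j / p ^ 1 : ℕ) + (j % p ^ 1 : ℕ) := by
        exact_mod_cast this.symm
      linear_combination h4
    rw [h3, inflate_apply hp h2, hk _ h1, ← col_add hp h1 h2, mul_comm, Nat.div_add_mod]
  have happ : ∀ (n : ℕ) (a : A), Appears (iter τ n a) S := by
    intro n a
    obtain ⟨b, hb⟩ := exists_mem_iter_one hp hprim a
    have := happ1 n b
    rw [add_comm] at this
    exact this.of_infix (iter_infix τ hb)
  have := (isLeast_subshift hp hprim).2 ⟨isSubshift_of_translate hcl htr, happ⟩ hx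
  simp only [hS, Set.mem_iUnion] at this
  obtain ⟨k, hk, y, hy, rfl⟩ := this
  exact ⟨k, hk, y, hy, rfl⟩

theorem exists_translate_inflate (hp : IsConstantLength τ p) (hprim : IsPrimitive τ) (n : ℕ)
    {x : ℤ → A} (hx : x ∈ subshift τ) :
    ∃ k : ℤ, ∃ y ∈ subshift τ, x = translate k (inflate τ p n y) := by
  induction n with
  | zero => exact ⟨0, x, hx, by rw [inflate_zero hp, translate_zero]⟩
  | succ n ih =>
    obtain ⟨k, y, hy, rfl⟩ := ih
    obtain ⟨l, -, z, hz, rfl⟩ := exists_translate_inflate_one hp hprim hy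
    refine ⟨k + (p ^ n : ℕ) * l, z, hz, ?_⟩
    rw [← translate_inflate hp, translate_translate, inflate_add hp]

/-- Minimality of `X_τ`. -/
theorem subshift_subset_of_closed (hp : IsConstantLength τ p) (hprim : IsPrimitive τ)
    {Z : Set (ℤ → A)} (hZ : Z ⊆ subshift τ) (hcl : IsClosed Z)
    (htr : ∀ e, ∀ x ∈ Z, translate e x ∈ Z) (hne : Z.Nonempty) : subshift τ ⊆ Z := by
  refine (isLeast_subshift hp hprim).2 ⟨isSubshift_of_translate hcl htr, fun n a => ?_⟩
  obtain ⟨z, hz⟩ := hne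
  obtain ⟨N, hN⟩ := id hprim
  -- Every point contains a full block `τⁿ⁺ᴺ(c)`, which by primitivity contains `τⁿ(a)` for all `a`.
  obtain ⟨k, y, -, hy⟩ := exists_translate_inflate hp hprim (n + N) (hZ hz)
  have : Appears (iter τ (n + N) (y 0)) Z := by
    refine ⟨z, hz, -k, ?_⟩
    rw [word_iter_iff hp]
    intro j hj
    rw [hy, translate_apply, ← inflate_nonneg_lt hp hj]
    congr 1; ring
  exact this.of_infix (iter_infix τ (hN a (y 0)))

/-- The components `Tᵉ τⁿ(X)` either are disjoint or agree. -/
theorem forall_translate_inflate (hp : IsConstantLength τ p) (hprim : IsPrimitive τ) {n : ℕ}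
    {e : ℤ} (h : ∃ x ∈ subshift τ, ∃ y ∈ subshift τ,
      translate e (inflate τ p n x) = inflate τ p n y) :
    ∀ x ∈ subshift τ, ∃ y ∈ subshift τ, translate e (inflate τ p n x) = inflate τ p n y := by
  -- The points sent into `τⁿ(X)` form a closed set, invariant because `τⁿ` turns `T` into the
  -- `pⁿ`-th power of `T`; by minimality it is all of `X` once it is nonempty.
  set Z : Set (ℤ → A) := subshift τ ∩
    (fun x => translate e (inflate τ p n x)) ⁻¹' (inflate τ p n '' subshift τ) with hZ
  have hcl : IsClosed Z := isClosed_subshift.inter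
    ((isCompact_subshift.image (continuous_inflate n)).isClosed.preimage
      ((continuous_translate e).comp (continuous_inflate n)))
  have htr : ∀ f, ∀ x ∈ Z, translate f x ∈ Z := by
    rintro f x ⟨hx, y, hy, hxy⟩
    refine ⟨translate_mem hx f, translate f y, translate_mem hy f, ?_⟩
    simp only at hxy ⊢
    rw [← translate_inflate hp, ← translate_inflate hp, hxy, translate_translate,
      translate_translate, add_comm]
  have := subshift_subset_of_closed hp hprim Set.inter_subset_left hcl htr (by
    obtain ⟨x, hx, y, hy, hxy⟩ := h
    exact ⟨x, hx, y, hy, hxy.symm⟩)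
  intro x hx
  obtain ⟨-, y, hy, hxy⟩ := this hx
  exact ⟨y, hy, hxy.symm⟩

/-- The group of return times of `τⁿ(X)` to itself. -/
def returnTimes (hp : IsConstantLength τ p) (hprim : IsPrimitive τ)
    (hinf : (subshift τ).Infinite) (n : ℕ) : AddSubgroup ℤ where
  carrier := {e | ∃ x ∈ subshift τ, ∃ y ∈ subshift τ,
    translate e (inflate τ p n x) = inflate τ p n y}
  zero_mem' := by
    obtain ⟨x, hx⟩ := hinf.nonempty
    exact ⟨x, hx, x, hx, translate_zero _⟩
  add_mem' := by
    rintro e f ⟨x, hx, y, hy, hxy⟩ hf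
    obtain ⟨z, hz, hyz⟩ := forall_translate_inflate hp hprim hf y hy
    refine ⟨x, hx, z, hz, ?_⟩
    rw [← hyz, ← hxy, translate_translate, add_comm]
  neg_mem' := by
    rintro e ⟨x, hx, y, hy, hxy⟩
    refine ⟨y, hy, x, hx, ?_⟩
    rw [← hxy, translate_translate, neg_add_cancel, translate_zero]

theorem pow_mem_returnTimes (hp : IsConstantLength τ p) (hprim : IsPrimitive τ)
    (hinf : (subshift τ).Infinite) (n : ℕ) : ((p ^ n : ℕ) : ℤ) ∈ returnTimes hp hprim hinf n := by
  obtain ⟨x, hx⟩ := hinf.nonempty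
  refine ⟨x, hx, translate 1 x, translate_mem hx 1, ?_⟩
  rw [← translate_inflate hp, mul_one]

theorem exists_generator (hp : IsConstantLength τ p) (hprim : IsPrimitive τ)
    (hinf : (subshift τ).Infinite) (n : ℕ) :
    ∃ d : ℕ, ∀ e : ℤ, e ∈ returnTimes hp hprim hinf n ↔ (d : ℤ) ∣ e := by
  obtain ⟨g, hg⟩ := Int.subgroup_cyclic (returnTimes hp hprim hinf n)
  refine ⟨g.natAbs, fun e => ?_⟩
  rw [hg, AddSubgroup.mem_closure_singleton, Int.natAbs_dvd, dvd_def]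
  constructor
  · rintro ⟨k, hk⟩; exact ⟨k, by rw [← hk, smul_eq_mul, mul_comm]⟩
  · rintro ⟨k, hk⟩; exact ⟨k, by rw [hk, smul_eq_mul, mul_comm]⟩

/-- Conjugating `Tᵉ` by `τⁿ` gives a block code on two letters. -/
theorem exists_blockCode (hp : IsConstantLength τ p) (hprim : IsPrimitive τ)
    (hinj : Function.Injective τ) (hinf : (subshift τ).Infinite) {n e : ℕ} (he : e ≤ p ^ n)
    (h : (e : ℤ) ∈ returnTimes hp hprim hinf n) :
    ∃ f : A → A → A, ∀ x ∈ subshift τ, blockCode f x ∈ subshift τ ∧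
      translate e (inflate τ p n x) = inflate τ p n (blockCode f x) := by
  classical
  have h' := forall_translate_inflate hp hprim h
  choose! S hS hSx using h'
  -- Since `e ≤ pⁿ`, the block of `Tᵉ τⁿ(x)` at the origin lies in `[0, 2pⁿ)`, so it depends only on
  -- `x 0` and `x 1`, and any point showing these letters can define the rule. The default `a` is
  -- never met on `X`.
  refine ⟨fun a b => if h : ∃ x ∈ subshift τ, x 0 = a ∧ x 1 = b then S h.choose 0 else a,
    fun x hx => ?_⟩
  have key : blockCode (fun a b =>
      if h : ∃ x ∈ subshift τ, x 0 = a ∧ x 1 = b then S h.choose 0 else a) x = S x := by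
    funext t
    have hex : ∃ z ∈ subshift τ, z 0 = x t ∧ z 1 = x (t + 1) :=
      ⟨translate t x, translate_mem hx t, by simp [translate], by simp [translate, add_comm]⟩
    simp only [blockCode, hex, dite_true]
    obtain ⟨hz, h0, h1⟩ := hex.choose_spec
    generalize hex.choose = z at hz h0 h1
    apply eq_of_col_eq hp hinj (n := n)
    intro j hj
    rw [← inflate_apply hp hj, ← inflate_apply hp hj, ← hSx x hx, ← hSx z hz, translate_apply,
      translate_apply]
    have := inflate_congr hp (n := n) (x := z) (y := x) (s := 0) (t := t) h0 (by simpa using h1)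
      (i := j + e) (by omega)
    push_cast at this ⊢
    rw [← add_assoc, ← add_assoc] at this
    exact this
  rw [key]
  exact ⟨hS x hx, hSx x hx⟩

/-- Recognizability: `τⁿ(X)` meets `Tᵉ τⁿ(X)` only if `pⁿ` divides `e`. -/
theorem pow_dvd_of_translate_inflate (hp : IsConstantLength τ p) (hprim : IsPrimitive τ)
    (hinj : Function.Injective τ) (hinf : (subshift τ).Infinite) {n : ℕ} {e : ℤ} {x y : ℤ → A}
    (hx : x ∈ subshift τ) (hy : y ∈ subshift τ)
    (hxy : translate e (inflate τ p n x) = inflate τ p n y) : ((p ^ n : ℕ) : ℤ) ∣ e := by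
  -- Here `d n` generates the return times at level `n`; with `q n = pⁿ / d n` the claim is `q n =
  -- 1`.
  choose d hd using exists_generator hp hprim hinf
  have hdvd : ∀ n, d n ∣ p ^ n := fun n => by
    have := (hd n _).1 (pow_mem_returnTimes hp hprim hinf n)
    exact_mod_cast this
  choose q hq using hdvd
  have hdpos : ∀ n, 0 < d n := fun n =>
    Nat.pos_of_ne_zero fun h => (hp.pow_pos n).ne' (by rw [hq, h, zero_mul])
  have hqpos : ∀ n, 0 < q n := fun n =>
    Nat.pos_of_ne_zero fun h => (hp.pow_pos n).ne' (by rw [hq, h, mul_zero])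
  -- `q` is nondecreasing
  have hdsucc : ∀ n, d (n + 1) ∣ p * d n := by
    intro n
    obtain ⟨x, hx, y, hy, hxy⟩ := (hd n (d n)).2 dvd_rfl
    have : ((p * d n : ℕ) : ℤ) ∈ returnTimes hp hprim hinf (n + 1) := by
      refine ⟨x, hx, y, hy, ?_⟩
      have h1 := translate_inflate hp 1 (d n) (inflate τ p n x)
      rw [hxy, inflate_add hp, inflate_add hp, pow_one, add_comm 1 n] at h1
      rw [← h1]; congr 1
    exact_mod_cast (hd _ _).1 this
  have hqmono : Monotone q := by
    refine monotone_nat_of_le_succ fun n => ?_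
    have h1 := Nat.le_of_dvd (Nat.mul_pos hp.pos (hdpos n)) (hdsucc n)
    have h2 := hq n
    have h3 := hq (n + 1)
    have h4 : p * d n * q n ≤ p * d n * q (n + 1) := by
      calc p * d n * q n = d (n + 1) * q (n + 1) := by rw [← h3, pow_succ, h2]; ring
        _ ≤ _ := Nat.mul_le_mul_right _ h1
    exact Nat.le_of_mul_le_mul_left h4 (Nat.mul_pos hp.pos (hdpos n))
  -- `q` takes finitely many values
  have hcode : ∀ n, ∃ f : A → A → A, ∀ x ∈ subshift τ, blockCode f x ∈ subshift τ ∧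
      translate (d n) (inflate τ p n x) = inflate τ p n (blockCode f x) := fun n =>
    exists_blockCode hp hprim hinj hinf (by rw [hq]; exact Nat.le_mul_of_pos_right _ (hqpos n))
      ((hd n _).2 dvd_rfl)
  choose f hf using hcode
  -- The code conjugate to `T^{d n}` is a `q n`-th root of the shift, because `d n * q n = pⁿ`.
  have hroot : ∀ n k, ∀ x ∈ subshift τ,
      (blockCode (f n))^[q n * k] x = translate (k : ℤ) x := by
    intro n k x hx
    apply inflate_injective hp hinj n
    rw [← (iterate_blockCode (hf n) (q n * k) hx).2, ← translate_inflate hp, ← mul_assoc, ← hq]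
    push_cast; rfl
  -- For a common rule, its power of exponent `q n * q m` is both `T^{q m}` and `T^{q n}`; unequal
  -- orders would give all of `X` a common period.
  have hfq : ∀ n m, f n = f m → q n ≤ q m := by
    intro n m hnm
    by_contra hlt
    obtain ⟨r, hr⟩ := Nat.exists_eq_add_of_le (not_le.1 hlt).le
    refine not_forall_periodic hinf (r := r) (by omega) fun x hx => ?_
    have h1 := hroot n (q m) x hx
    have h2 := hroot m (q n) x hx
    rw [hnm, mul_comm, h2] at h1
    have h3 : translate (-(q m : ℤ)) (translate (q n : ℤ) x)
        = translate (-(q m : ℤ)) (translate (q m : ℤ) x) := by rw [h1]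
    rw [translate_translate, translate_translate, neg_add_cancel, translate_zero] at h3
    rwa [show -(q m : ℤ) + q n = r by rw [hr]; push_cast; ring] at h3
  have hbdd : ∃ B, ∀ n, q n ≤ B := by
    have : (Set.range q).Finite := by
      have h1 : (Set.range f).Finite := Set.toFinite _
      have h2 : ∀ n m, f n = f m → q n = q m := fun n m h => le_antisymm (hfq _ _ h) (hfq _ _ h.symm)
      have h3 : Set.range q ⊆ (fun g => q (Function.invFun f g)) '' Set.range f := by
        rintro _ ⟨n, rfl⟩
        exact ⟨f n, ⟨n, rfl⟩, h2 _ _ (Function.invFun_eq ⟨n, rfl⟩)⟩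
      exact (h1.image _).subset h3
    obtain ⟨B, hB⟩ := this.bddAbove
    exact ⟨B, fun n => hB ⟨n, rfl⟩⟩
  obtain ⟨B, hB⟩ := hbdd
  obtain ⟨m, hnm, hm⟩ : ∃ m, n ≤ m ∧ q (m + 1) = q m := by
    by_contra! hne
    have : ∀ k, k ≤ q (n + k) := by
      intro k
      induction k with
      | zero => simp
      | succ k ih =>
        have h1 := hqmono (Nat.le_succ (n + k))
        have h2 := hne (n + k) (by omega)
        rw [Nat.succ_eq_add_one] at h1
        rw [← add_assoc]; omega
    have := this (B + 1)
    have := hB (n + (B + 1))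
    omega
  -- where `q` is stable it equals `1`
  have hdm : d (m + 1) = p * d m := by
    have h2 := hq m
    have h3 := hq (m + 1)
    rw [hm, pow_succ, h2] at h3
    exact (Nat.eq_of_mul_eq_mul_right (hqpos m) (by rw [← h3]; ring)).symm
  -- Desubstituting the image of a point of `τ(X)` gives a return time `d m * (1 - q m * j)` at
  -- level `m + 1`. It is divisible by `p * d m`, so `q m` is coprime to `p` while dividing `pᵐ`.
  have hqm : q m = 1 := by
    obtain ⟨x, hx⟩ := hinf.nonempty
    obtain ⟨y, hy, hxy⟩ := forall_translate_inflate hp hprim ((hd m (d m)).2 dvd_rfl) _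
      (inflate_mem hp hx 1)
    obtain ⟨j, z, hz, rfl⟩ := exists_translate_inflate hp hprim 1 hy
    rw [← translate_inflate hp, inflate_add hp, inflate_add hp] at hxy
    have h1 : (d m : ℤ) - (p ^ m : ℕ) * j ∈ returnTimes hp hprim hinf (m + 1) := by
      refine ⟨x, hx, z, hz, ?_⟩
      rw [sub_eq_neg_add, ← translate_translate, hxy, translate_translate, neg_add_cancel,
        translate_zero]
    rw [hd, hdm, hq m] at h1
    have h2 : (p : ℤ) ∣ 1 - q m * j := by
      obtain ⟨c, hc⟩ := h1
      refine ⟨c, ?_⟩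
      have h0 : (d m : ℤ) ≠ 0 := by exact_mod_cast (hdpos m).ne'
      apply mul_left_cancel₀ h0
      push_cast at hc
      linear_combination hc
    have h3 : IsCoprime (q m : ℤ) (p : ℤ) := by
      obtain ⟨c, hc⟩ := h2
      exact ⟨j, c, by linear_combination -hc⟩
    have h4 : Nat.Coprime (q m) (p ^ m) := Nat.Coprime.pow_right _ (Nat.isCoprime_iff_coprime.1 h3)
    exact Nat.Coprime.eq_one_of_dvd h4 ⟨d m, by rw [hq m, mul_comm]⟩
  have hqn : q n = 1 := le_antisymm (hqm ▸ hqmono hnm) (hqpos n)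
  have := (hd n e).1 ⟨x, hx, y, hy, hxy⟩
  rwa [hq n, hqn, mul_one]

end Topology

/-! ### Li–Yorke pairs in coordinates -/

theorem seqDist_nonneg (x y : ℤ → A) : 0 ≤ seqDist x y := by
  unfold seqDist; split_ifs <;> positivity

theorem seqDist_le_one (x y : ℤ → A) : seqDist x y ≤ 1 := by
  unfold seqDist
  split_ifs
  · exact zero_le_one
  · exact pow_le_one₀ (by norm_num) (by norm_num)

theorem seqDist_eq_one {x y : ℤ → A} (h : x 0 ≠ y 0) : seqDist x y = 1 := by
  have hne : x ≠ y := fun e => h (by rw [e])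
  have h0 : sInf {n : ℕ | ∃ i : ℤ, i.natAbs = n ∧ x i ≠ y i} = 0 :=
    Nat.sInf_eq_zero.2 (Or.inl ⟨0, rfl, h⟩)
  rw [seqDist, if_neg hne, h0, pow_zero]

theorem seqDist_le_iff {x y : ℤ → A} {L : ℕ} :
    seqDist x y ≤ (1 / 2 : ℝ) ^ (L + 1) ↔ ∀ i : ℤ, i.natAbs ≤ L → x i = y i := by
  unfold seqDist
  split_ifs with h
  · subst h
    simp only [implies_true, iff_true]
    positivity
  · have hne : {n : ℕ | ∃ i : ℤ, i.natAbs = n ∧ x i ≠ y i}.Nonempty := by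
      obtain ⟨i, hi⟩ := Function.ne_iff.1 h
      exact ⟨_, i, rfl, hi⟩
    rw [pow_le_pow_iff_right_of_lt_one₀ (by norm_num) (by norm_num),
      le_csInf_iff (OrderBot.bddBelow _) hne]
    constructor
    · intro H i hi
      by_contra hxy
      have := H _ ⟨i, rfl, hxy⟩
      omega
    · rintro H n ⟨i, rfl, hxy⟩
      by_contra hlt
      exact hxy (H i (by omega))

theorem shift_iterate_apply (n : ℕ) (x : ℤ → A) (i : ℤ) : (shift^[n] x) i = x (n + i) := by
  have := shift_zpow_apply (n : ℤ) x i
  rw [zpow_natCast, Equiv.Perm.coe_pow] at this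
  rw [this, add_comm]

/-- Li–Yorke pairs of `A^ℤ` in terms of coordinates. -/
theorem isLiYorkePair_iff {x y : ℤ → A} : IsLiYorkePair seqDist shift x y ↔
    (∃ᶠ n : ℕ in atTop, x n ≠ y n) ∧
      ∀ L : ℕ, ∃ᶠ n : ℕ in atTop, ∀ i : ℤ, i.natAbs ≤ L → x (n + i) = y (n + i) := by
  set u : ℕ → ℝ := fun n => seqDist (shift^[n] x) (shift^[n] y) with hu
  have hb1 : IsBoundedUnder (· ≤ ·) atTop u :=
    isBoundedUnder_of ⟨1, fun n => seqDist_le_one _ _⟩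
  have hb0 : IsBoundedUnder (· ≥ ·) atTop u :=
    isBoundedUnder_of ⟨0, fun n => seqDist_nonneg _ _⟩
  have hle : ∀ n L, u n ≤ (1 / 2 : ℝ) ^ (L + 1) ↔
      ∀ i : ℤ, i.natAbs ≤ L → x (n + i) = y (n + i) := fun n L => by
    simp only [hu, seqDist_le_iff, shift_iterate_apply]
  refine and_congr ?_ ?_
  · change 0 < limsup u atTop ↔ _
    constructor
    · intro h
      by_contra hf
      rw [not_frequently] at hf
      have hlim : Tendsto u atTop (nhds 0) := by
        rw [Metric.tendsto_atTop]
        intro ε hε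
        obtain ⟨L, hL⟩ := exists_pow_lt_of_lt_one hε (by norm_num : (1 / 2 : ℝ) < 1)
        obtain ⟨N, hN⟩ := eventually_atTop.1 hf
        refine ⟨N + L, fun n hn => ?_⟩
        have h1 : u n ≤ (1 / 2 : ℝ) ^ (L + 1) := by
          rw [hle]
          intro i hi
          have h2 := hN (n + i).toNat (by omega)
          rw [not_not, Int.toNat_of_nonneg (by omega)] at h2
          exact h2
        have h3 : (1 / 2 : ℝ) ^ (L + 1) ≤ (1 / 2 : ℝ) ^ L :=
          pow_le_pow_of_le_one (by norm_num) (by norm_num) (Nat.le_succ L)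
        rw [Real.dist_0_eq_abs, abs_of_nonneg (seqDist_nonneg _ _)]
        linarith
      rw [hlim.limsup_eq] at h
      exact lt_irrefl _ h
    · intro h
      refine lt_of_lt_of_le zero_lt_one (le_limsup_of_frequently_le (h.mono fun n hn => ?_) hb1)
      refine (seqDist_eq_one ?_).ge
      simpa [shift_iterate_apply] using hn
  · change liminf u atTop = 0 ↔ _
    constructor
    · intro h L
      have : ∃ᶠ n in atTop, u n < (1 / 2 : ℝ) ^ (L + 1) :=
        frequently_lt_of_liminf_lt hb1.isCoboundedUnder_ge (by rw [h]; positivity)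
      exact this.mono fun n hn => (hle n L).1 hn.le
    · intro h
      apply le_antisymm
      · apply le_of_forall_pos_le_add
        intro ε hε
        obtain ⟨L, hL⟩ := exists_pow_lt_of_lt_one hε (by norm_num : (1 / 2 : ℝ) < 1)
        have h3 : (1 / 2 : ℝ) ^ (L + 1) ≤ (1 / 2 : ℝ) ^ L :=
          pow_le_pow_of_le_one (by norm_num) (by norm_num) (Nat.le_succ L)
        have : liminf u atTop ≤ (1 / 2 : ℝ) ^ (L + 1) :=
          liminf_le_of_frequently_le ((h L).mono fun n hn => (hle n L).2 hn) hb0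
        linarith
      · exact le_liminf_of_le hb1.isCoboundedUnder_ge
          (Eventually.of_forall fun n => seqDist_nonneg _ _)

/-! ### Prescribed addresses and uncountably many pairs -/

/-- The number with base-`b` digits `ε 0, …, ε (n - 1)`. -/
def digitSum (b : ℕ) (ε : ℕ → ℕ) (n : ℕ) : ℕ := ∑ l ∈ Finset.range n, ε l * b ^ l

theorem digitSum_succ (b : ℕ) (ε : ℕ → ℕ) (n : ℕ) :
    digitSum b ε (n + 1) = digitSum b ε n + ε n * b ^ n := Finset.sum_range_succ _ _

theorem digitSum_lt {b : ℕ} {ε : ℕ → ℕ} (h : ∀ n, ε n < b) (n : ℕ) : digitSum b ε n < b ^ n := by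
  induction n with
  | zero => simp [digitSum]
  | succ n ih =>
    rw [digitSum_succ, pow_succ]
    calc _ < b ^ n + ε n * b ^ n := by omega
      _ = (ε n + 1) * b ^ n := by ring
      _ ≤ b * b ^ n := Nat.mul_le_mul_right _ (h n)
      _ = _ := mul_comm _ _

/-- A point of `X_τ` whose position inside the `τ^{mn}`-blocks is prescribed for all `n`. -/
theorem exists_mem_of_digits [Finite A] (hp : IsConstantLength τ p) (hprim : IsPrimitive τ)
    {m : ℕ} {a : A} {ε : ℕ → ℕ} (hε : ∀ n, ε n < p ^ m) (ha : ∀ n, col τ m a (ε n) = a) :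
    ∃ x ∈ subshift τ, ∀ n, ∃ z ∈ subshift τ, z 0 = a ∧
      x = translate (digitSum (p ^ m) ε n) (inflate τ p (m * n) z) := by
  let _ : TopologicalSpace A := ⊥
  have : DiscreteTopology A := ⟨rfl⟩
  set F : Set (ℤ → A) := subshift τ ∩ {z | z 0 = a} with hF
  have hFc : IsCompact F := isCompact_subshift.inter_right
    (isClosed_eq (continuous_apply 0) continuous_const)
  have hFn : F.Nonempty := by
    obtain ⟨x, hx, k, hk⟩ := appears_subshift hp hprim 0 a
    rw [word_iter_iff hp] at hk
    refine ⟨translate k x, translate_mem hx k, ?_⟩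
    simpa [col_zero, translate] using hk 0 (by simp)
  -- These compact sets decrease because position `ε n` of `τᵐ(a)` carries `a` again; a common point
  -- has all the prescribed digits.
  set G : ℕ → Set (ℤ → A) := fun n =>
    (fun z => translate (digitSum (p ^ m) ε n : ℤ) (inflate τ p (m * n) z)) '' F with hG
  have hGc : ∀ n, IsCompact (G n) := fun n =>
    hFc.image ((continuous_translate _).comp (continuous_inflate _))
  obtain ⟨x, hx⟩ := IsCompact.nonempty_iInter_of_sequence_nonempty_isCompact_isClosed G
    (by
      rintro n _ ⟨z, ⟨hz, hz0⟩, rfl⟩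
      refine ⟨translate (ε n) (inflate τ p m z),
        ⟨translate_mem (inflate_mem hp hz m) _, ?_⟩, ?_⟩
      · rw [Set.mem_ofPred_eq, translate_apply, zero_add, inflate_nonneg_lt hp (hε n), hz0, ha]
      · simp only
        rw [← translate_inflate hp, translate_translate, inflate_add hp, digitSum_succ,
          ← pow_mul, mul_add, mul_one]
        congr 1; push_cast; ring)
    (fun n => hFn.image _) (hGc 0) (fun n => (hGc n).isClosed)
  rw [Set.mem_iInter] at hx
  have key : ∀ n, ∃ z ∈ subshift τ, z 0 = a ∧
      x = translate (digitSum (p ^ m) ε n) (inflate τ p (m * n) z) := by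
    intro n
    obtain ⟨z, ⟨hz, hz0⟩, rfl⟩ := hx n
    exact ⟨z, hz, hz0, rfl⟩
  refine ⟨x, ?_, key⟩
  obtain ⟨z, hz, -, rfl⟩ := key 0
  exact translate_mem (inflate_mem hp hz _) _

/-- Recognizability: the position in the `τⁿ`-blocks is determined by the point. -/
theorem eq_of_translate_inflate_eq [Finite A] (hp : IsConstantLength τ p) (hprim : IsPrimitive τ)
    (hinj : Function.Injective τ) (hinf : (subshift τ).Infinite) {n k l : ℕ} {x y : ℤ → A}
    (hk : k < p ^ n) (hl : l < p ^ n) (hx : x ∈ subshift τ) (hy : y ∈ subshift τ)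
    (h : translate k (inflate τ p n x) = translate l (inflate τ p n y)) : k = l := by
  let _ : TopologicalSpace A := ⊥
  have : DiscreteTopology A := ⟨rfl⟩
  have h1 : translate ((k : ℤ) - l) (inflate τ p n x) = inflate τ p n y := by
    rw [sub_eq_neg_add, ← translate_translate, h, translate_translate, neg_add_cancel,
      translate_zero]
  have h2 := pow_dvd_of_translate_inflate hp hprim hinj hinf hx hy h1
  have h3 := Int.eq_zero_of_abs_lt_dvd h2 (by rw [abs_lt]; omega)
  omega

/-- At each level with digit `i`, block `j` to the right repeats the words around the origin, which
gives a difference, and block `k` to the right is the same word in both points, which gives a long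
agreement. -/
theorem isLiYorkePair_of_digits (hp : IsConstantLength τ p) {m : ℕ} {a b : A} (hab : a ≠ b)
    {i j k : ℕ} (hij : i < j) (hik : i < k) (hj : j < p ^ m) (hk : k < p ^ m)
    (haj : col τ m a j = a) (hbj : col τ m b j = b) (hc : col τ m a k = col τ m b k)
    {ε : ℕ → ℕ} (hε : ∀ n, ε n < p ^ m) (hfreq : ∃ᶠ n in atTop, ε n = i) {x y : ℤ → A}
    (hx : ∀ n, ∃ z ∈ subshift τ, z 0 = a ∧
      x = translate (digitSum (p ^ m) ε n) (inflate τ p (m * n) z))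
    (hy : ∀ n, ∃ z ∈ subshift τ, z 0 = b ∧
      y = translate (digitSum (p ^ m) ε n) (inflate τ p (m * n) z)) :
    IsLiYorkePair seqDist shift x y := by
  have hP : ∀ n, p ^ (m * n) = (p ^ m) ^ n := fun n => pow_mul _ _ _
  have hP2 : 2 ≤ p ^ m := by omega
  have hlt : ∀ n, n < (p ^ m) ^ n := fun n => Nat.lt_pow_self hP2
  have hK : ∀ n, digitSum (p ^ m) ε n < p ^ (m * n) := fun n => by
    rw [hP]; exact digitSum_lt hε n
  -- the letters of block `l` inside the block of level `n + 1` around the origin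
  have block : ∀ {x : ℤ → A} {a : A}, (∀ n, ∃ z ∈ subshift τ, z 0 = a ∧
      x = translate (digitSum (p ^ m) ε n) (inflate τ p (m * n) z)) →
      ∀ {n l s : ℕ}, ε n = i → l < p ^ m → s < p ^ (m * n) →
      x ((s : ℤ) + l * p ^ (m * n) - digitSum (p ^ m) ε n - i * p ^ (m * n))
        = col τ (m * n) (col τ m a l) s := by
    intro x a hx n l s hn hl hs
    obtain ⟨z, -, hz, rfl⟩ := hx (n + 1)
    have h1 : l * p ^ (m * n) + s < p ^ (m * (n + 1)) := by
      rw [mul_add, mul_one, pow_add]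
      calc _ < (l + 1) * p ^ (m * n) := by rw [add_mul]; omega
        _ ≤ p ^ m * p ^ (m * n) := Nat.mul_le_mul_right _ hl
        _ = _ := mul_comm _ _
    have h2 := inflate_nonneg_lt hp h1 z
    rw [hz] at h2
    rw [← col_add hp hl hs, ← mul_add_one, ← h2, translate_apply, digitSum_succ, hn, hP]
    congr 1; push_cast; ring
  have origin : ∀ {x : ℤ → A} {a : A}, (∀ n, ∃ z ∈ subshift τ, z 0 = a ∧
      x = translate (digitSum (p ^ m) ε n) (inflate τ p (m * n) z)) →
      ∀ n, col τ (m * n) a (digitSum (p ^ m) ε n) = x 0 := by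
    intro x a hx n
    obtain ⟨z, -, hz, rfl⟩ := hx n
    rw [translate_apply, zero_add, inflate_nonneg_lt hp (hK n), hz]
  rw [isLiYorkePair_iff]
  have h0 : x 0 = a ∧ y 0 = b := by
    have h1 := origin hx 0
    have h2 := origin hy 0
    simp only [mul_zero, digitSum, Finset.range_zero, Finset.sum_empty, col_zero] at h1 h2
    exact ⟨h1.symm, h2.symm⟩
  constructor
  · rw [frequently_atTop] at hfreq ⊢
    intro N
    obtain ⟨n, hn, hni⟩ := hfreq N
    have h1 := block hx hni hj (hK n)
    have h2 := block hy hni hj (hK n)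
    rw [haj, origin hx, h0.1] at h1
    rw [hbj, origin hy, h0.2] at h2
    -- Moving from block `i` to block `j` keeps the offset inside the block, so the letters `a` and
    -- `b` of the origin reappear.
    refine ⟨(j - i) * p ^ (m * n), ?_, ?_⟩
    · have := hlt n
      rw [hP]
      have : 1 * (p ^ m) ^ n ≤ (j - i) * (p ^ m) ^ n := Nat.mul_le_mul_right _ (by omega)
      omega
    · have e : (((j - i) * p ^ (m * n) : ℕ) : ℤ) = (digitSum (p ^ m) ε n : ℤ) + j * p ^ (m * n)
          - digitSum (p ^ m) ε n - i * p ^ (m * n) := by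
        push_cast [Nat.cast_sub hij.le]; ring
      rw [e, h1, h2]; exact hab
  · intro L
    rw [frequently_atTop] at hfreq ⊢
    intro N
    obtain ⟨n, hn, hni⟩ := hfreq (2 * (N + L) + 2)
    have hbig := hlt n
    rw [← hP] at hbig
    have hKn := hK n
    obtain ⟨d, rfl⟩ := Nat.exists_eq_add_of_le hik.le
    have hd : 1 ≤ d := by omega
    have hmul : 1 * p ^ (m * n) ≤ d * p ^ (m * n) := Nat.mul_le_mul_right _ hd
    -- The window is centred at offset `N + L` of block `k`; the choice of `n` makes that block
    -- longer than `N + 2 * L`.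
    refine ⟨N + L + d * p ^ (m * n) - digitSum (p ^ m) ε n, by omega, ?_⟩
    intro t ht
    have h1 := block hx hni hk (s := (N + L + t).toNat) (by omega)
    have h2 := block hy hni hk (s := (N + L + t).toNat) (by omega)
    rw [hc, ← h2] at h1
    have e : (((N + L + d * p ^ (m * n) - digitSum (p ^ m) ε n : ℕ) : ℤ)) + t
        = ((N + L + t).toNat : ℤ) + ((i + d : ℕ) : ℤ) * p ^ (m * n) - digitSum (p ^ m) ε n
          - i * p ^ (m * n) := by
      rw [Int.toNat_of_nonneg (by omega), Nat.cast_sub (by omega)]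
      push_cast; ring
    rw [e, h1]

/-- The coincidence condition yields uncountably many Li–Yorke pairs. -/
theorem not_countable_of_coincidenceCondition [Finite A] (hp : IsConstantLength τ p)
    (hprim : IsPrimitive τ) (hinj : Function.Injective τ) (hinf : (subshift τ).Infinite)
    (h : CoincidenceCondition τ) : ¬ (liYorkePairs τ).Countable := by
  obtain ⟨m, a, b, hab, i, j, k, hij, hik, hj, hk, hai, hbi, haj, hbj, hc⟩ :=
    (coincidenceCondition_iff hp).1 h
  -- Even places are fixed at `i` so that `i` occurs infinitely often; the odd places encode `δ`.
  set ε : (ℕ → Bool) → ℕ → ℕ := fun δ n => if Even n ∨ δ (n / 2) then i else j with hεdef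
  have hεij : ∀ δ n, ε δ n = i ∨ ε δ n = j := fun δ n => by
    simp only [hεdef]; split_ifs <;> simp
  have hε : ∀ δ n, ε δ n < p ^ m := fun δ n => by rcases hεij δ n with h | h <;> omega
  have hfreq : ∀ δ, ∃ᶠ n in atTop, ε δ n = i := fun δ => by
    rw [frequently_atTop]
    exact fun N => ⟨2 * N, by omega, by simp [hεdef]⟩
  have hεa : ∀ δ n, col τ m a (ε δ n) = a := fun δ n => by
    rcases hεij δ n with h | h <;> rw [h] <;> assumption
  have hεb : ∀ δ n, col τ m b (ε δ n) = b := fun δ n => by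
    rcases hεij δ n with h | h <;> rw [h] <;> assumption
  choose X hX hXd using fun δ => exists_mem_of_digits hp hprim (hε δ) (hεa δ)
  choose Y hY hYd using fun δ => exists_mem_of_digits hp hprim (hε δ) (hεb δ)
  have hmem : ∀ δ, (X δ, Y δ) ∈ liYorkePairs τ := fun δ => ⟨hX δ, hY δ,
    isLiYorkePair_of_digits hp hab hij hik hj hk haj hbj hc (hε δ) (hfreq δ) (hXd δ) (hYd δ)⟩
  -- Recognizability reads all the digits, hence `δ`, off the first point alone.
  have hXinj : Function.Injective X := by
    intro δ δ' hδ
    have hsum : ∀ n, digitSum (p ^ m) (ε δ) n = digitSum (p ^ m) (ε δ') n := by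
      intro n
      obtain ⟨z, hz, -, h1⟩ := hXd δ n
      obtain ⟨z', hz', -, h2⟩ := hXd δ' n
      have hK : ∀ δ, digitSum (p ^ m) (ε δ) n < p ^ (m * n) := fun δ => by
        rw [pow_mul]; exact digitSum_lt (hε δ) n
      exact eq_of_translate_inflate_eq hp hprim hinj hinf (hK δ) (hK δ') hz hz'
        (by rw [← h1, ← h2, hδ])
    have hdig : ∀ n, ε δ n = ε δ' n := by
      intro n
      have h1 := hsum (n + 1)
      rw [digitSum_succ, digitSum_succ, hsum n] at h1
      exact Nat.eq_of_mul_eq_mul_right (Nat.pow_pos (hp.pow_pos m)) (Nat.add_left_cancel h1)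
    funext n
    have h1 := hdig (2 * n + 1)
    have h2 : ¬ Even (2 * n + 1) := by simp
    have h3 : (2 * n + 1) / 2 = n := by omega
    simp only [hεdef, h2, h3, false_or] at h1
    cases hd : δ n <;> cases hd' : δ' n <;> simp [hd, hd'] at h1 ⊢ <;> omega
  intro hcount
  have h1 := hcount.to_subtype
  have : Countable (ℕ → Bool) := Function.Injective.countable
    (f := fun δ => (⟨(X δ, Y δ), hmem δ⟩ : liYorkePairs τ)) fun δ δ' hδ =>
      hXinj (congrArg (fun q => q.1.1) hδ)
  obtain ⟨g, hg⟩ := exists_surjective_nat (ℕ → Bool)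
  obtain ⟨n, hn⟩ := hg fun n => !(g n n)
  simpa using congrFun hn n

/-! ### Desubstitution of Li–Yorke pairs and towers -/

/-- Proximal points lie in the same component `Tᵏ τ(X)`. -/
theorem digit_eq_of_proximal [Finite A] (hp : IsConstantLength τ p) (hprim : IsPrimitive τ)
    (hinj : Function.Injective τ) (hinf : (subshift τ).Infinite) {k l : ℕ} {x y : ℤ → A}
    (hk : k < p) (hl : l < p) (hx : x ∈ subshift τ) (hy : y ∈ subshift τ)
    (h : ∀ L : ℕ, ∃ n : ℤ, ∀ i : ℤ, i.natAbs ≤ L → translate k (inflate τ p 1 x) (n + i)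
      = translate l (inflate τ p 1 y) (n + i)) : k = l := by
  let _ : TopologicalSpace A := ⊥
  have : DiscreteTopology A := ⟨rfl⟩
  -- Agreement on ever longer windows passes to a limit pair `(u, v)` with `Tᵏ τ(u) = Tˡ τ(v)`, to
  -- which recognizability applies.
  set G : ℕ → Set ((ℤ → A) × (ℤ → A)) := fun L => (subshift τ ×ˢ subshift τ) ∩
    ⋂ (i : ℤ) (_ : i.natAbs ≤ L), {q | translate k (inflate τ p 1 q.1) i
      = translate l (inflate τ p 1 q.2) i} with hG
  have hcl : ∀ L, IsClosed (G L) := fun L =>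
    (isClosed_subshift.prod isClosed_subshift).inter <| isClosed_iInter fun i =>
      isClosed_iInter fun _ => isClosed_eq
        ((continuous_apply i).comp
          ((continuous_translate _).comp ((continuous_inflate 1).comp continuous_fst)))
        ((continuous_apply i).comp
          ((continuous_translate _).comp ((continuous_inflate 1).comp continuous_snd)))
  obtain ⟨⟨u, v⟩, huv⟩ := IsCompact.nonempty_iInter_of_sequence_nonempty_isCompact_isClosed G
    (by
      rintro L q ⟨hq, hq'⟩
      refine ⟨hq, ?_⟩
      simp only [Set.mem_iInter] at hq' ⊢
      exact fun i hi => hq' i (by omega))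
    (by
      intro L
      -- The margin `p` pays for recentring the window at a block boundary, which keeps `k` and `l`
      -- unchanged.
      obtain ⟨n, hn⟩ := h (L + p)
      obtain ⟨t, j, hj, rfl⟩ := exists_block hp 1 n
      refine ⟨(translate t x, translate t y),
        ⟨translate_mem hx t, translate_mem hy t⟩, ?_⟩
      simp only [Set.mem_iInter, Set.mem_ofPred_eq]
      intro i hi
      rw [pow_one] at hj
      have := hn (i - j) (by omega)
      rw [← translate_inflate hp, ← translate_inflate hp, translate_translate,
        translate_translate]
      simp only [translate_apply] at this ⊢
      convert this using 2 <;> ring)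
    ((isCompact_subshift.prod isCompact_subshift).of_isClosed_subset (hcl 0)
      Set.inter_subset_left) hcl
  rw [Set.mem_iInter] at huv
  refine eq_of_translate_inflate_eq hp hprim hinj hinf (n := 1) (by simpa) (by simpa)
    (huv 0).1.1 (huv 0).1.2 ?_
  funext i
  have := (huv i.natAbs).2
  simp only [Set.mem_iInter] at this
  exact this i le_rfl

/-- Li–Yorke pairs desubstitute simultaneously to Li–Yorke pairs. -/
theorem exists_desubstitution [Finite A] (hp : IsConstantLength τ p) (hprim : IsPrimitive τ)
    (hinj : Function.Injective τ) (hinf : (subshift τ).Infinite) {q : (ℤ → A) × (ℤ → A)}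
    (hq : q ∈ liYorkePairs τ) : ∃ k < p, ∃ q' ∈ liYorkePairs τ,
      q.1 = translate k (inflate τ p 1 q'.1) ∧ q.2 = translate k (inflate τ p 1 q'.2) := by
  let _ : TopologicalSpace A := ⊥
  have : DiscreteTopology A := ⟨rfl⟩
  obtain ⟨x, y⟩ := q
  obtain ⟨hx, hy, hLY⟩ := hq
  simp only at hx hy hLY ⊢
  rw [isLiYorkePair_iff] at hLY
  obtain ⟨hdiff, hagree⟩ := hLY
  obtain ⟨k, hk, x', hx', rfl⟩ := exists_translate_inflate_one hp hprim hx
  obtain ⟨l, hl, y', hy', rfl⟩ := exists_translate_inflate_one hp hprim hy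
  obtain rfl := digit_eq_of_proximal hp hprim hinj hinf hk hl hx' hy'
    fun L => (hagree L).exists.imp' _ fun n h => h
  refine ⟨k, hk, (x', y'), ⟨hx', hy', ?_⟩, rfl, rfl⟩
  rw [isLiYorkePair_iff]
  have hp2 := hp.1
  constructor
  · rw [frequently_atTop] at hdiff ⊢
    intro N
    obtain ⟨n, hn, hne⟩ := hdiff (p * N + p)
    obtain ⟨t, j, hj, ht⟩ := exists_block hp 1 (n + k : ℤ)
    have ht0 : (N : ℤ) ≤ t := by
      rw [pow_one] at hj ht
      by_contra hlt
      have : (p : ℤ) * t ≤ p * N := mul_le_mul_of_nonneg_left (by omega) (by omega)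
      have : ((p * N : ℕ) : ℤ) = p * N := by push_cast; ring
      omega
    refine ⟨t.toNat, by omega, fun heq => hne ?_⟩
    rw [Int.toNat_of_nonneg (by omega)] at heq
    rw [translate_apply, translate_apply, ht, inflate_apply hp hj, inflate_apply hp hj]
    simp only at heq
    rw [heq]
  · intro L
    -- The window is wide enough to contain the blocks `t - L, …, t + L` entirely; equal blocks then
    -- come from equal letters.
    have := hagree (p * L + 2 * p)
    rw [frequently_atTop] at this ⊢
    intro N
    obtain ⟨n, hn, hne⟩ := this (p * N + p)
    obtain ⟨t, j, hj, ht⟩ := exists_block hp 1 (n + k : ℤ)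
    have hj' := hj
    rw [pow_one] at hj' ht
    have ht0 : (N : ℤ) ≤ t := by
      by_contra hlt
      have : (p : ℤ) * t ≤ p * N := mul_le_mul_of_nonneg_left (by omega) (by omega)
      have : ((p * N : ℕ) : ℤ) = p * N := by push_cast; ring
      omega
    refine ⟨t.toNat, by omega, fun i hi => ?_⟩
    rw [Int.toNat_of_nonneg (by omega)]
    apply eq_of_col_eq hp hinj (n := 1)
    intro s hs
    have hs' := hs
    rw [pow_one] at hs'
    have h1 := hne (p * i + s - j) (by
      have : (p * i).natAbs ≤ p * L := by
        rw [Int.natAbs_mul, Int.natAbs_natCast]; exact Nat.mul_le_mul_left _ hi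
      omega)
    have e : (n : ℤ) + (p * i + s - j) + k = ((p ^ 1 : ℕ) : ℤ) * (t + i) + s := by
      rw [pow_one]; linear_combination ht
    rw [translate_apply, translate_apply, e, inflate_apply hp hs, inflate_apply hp hs] at h1
    exact h1

/-- A sequence of points in which `x n = T^{ε n} τ(x (n + 1))`. -/
structure IsTower (τ : A → List A) (p : ℕ) (ε : ℕ → ℕ) (x : ℕ → ℤ → A) : Prop where
  lt : ∀ n, ε n < p
  eq : ∀ n, x n = translate (ε n) (inflate τ p 1 (x (n + 1)))

theorem exists_tower [Finite A] (hp : IsConstantLength τ p) (hprim : IsPrimitive τ)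
    (hinj : Function.Injective τ) (hinf : (subshift τ).Infinite) {q : (ℤ → A) × (ℤ → A)}
    (hq : q ∈ liYorkePairs τ) : ∃ (ε : ℕ → ℕ) (x y : ℕ → ℤ → A), IsTower τ p ε x ∧
      IsTower τ p ε y ∧ q = (x 0, y 0) ∧ ∀ n, IsLiYorkePair seqDist shift (x n) (y n) := by
  have step : ∀ q : liYorkePairs τ, ∃ (k : ℕ) (q' : liYorkePairs τ), k < p ∧
      q.1.1 = translate k (inflate τ p 1 q'.1.1) ∧
      q.1.2 = translate k (inflate τ p 1 q'.1.2) := by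
    rintro ⟨q, hq⟩
    obtain ⟨k, hk, q', hq', h1, h2⟩ := exists_desubstitution hp hprim hinj hinf hq
    exact ⟨k, ⟨q', hq'⟩, hk, h1, h2⟩
  choose K D hK hD1 hD2 using step
  refine ⟨fun n => K (D^[n] ⟨q, hq⟩), fun n => (D^[n] ⟨q, hq⟩).1.1,
    fun n => (D^[n] ⟨q, hq⟩).1.2, ⟨fun n => hK _, fun n => ?_⟩, ⟨fun n => hK _, fun n => ?_⟩,
    rfl, fun n => (D^[n] ⟨q, hq⟩).2.2.2⟩
  · simp only [Function.iterate_succ_apply']; exact hD1 _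
  · simp only [Function.iterate_succ_apply']; exact hD2 _

theorem digitSum_add (b : ℕ) (ε : ℕ → ℕ) (l r : ℕ) :
    digitSum b ε (l + r) = digitSum b ε l + b ^ l * digitSum b (fun i => ε (l + i)) r := by
  induction r with
  | zero => simp [digitSum]
  | succ r ih => rw [← add_assoc, digitSum_succ, ih, digitSum_succ, pow_add]; ring

/-- A non-maximal digit at place `l` leaves more than `b ^ l` free positions before the end of the
block, and passing to higher places cannot reduce this room below that. -/
theorem digitSum_add_pow_lt {b : ℕ} {ε : ℕ → ℕ} (h : ∀ n, ε n < b) {l r : ℕ} (hl : ε l + 1 < b)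
    (hlr : l < r) : digitSum b ε r + b ^ l < b ^ r := by
  induction r, hlr using Nat.le_induction with
  | base =>
    rw [Nat.succ_eq_add_one, digitSum_succ, pow_succ]
    have := digitSum_lt h l
    calc _ < (ε l + 2) * b ^ l := by rw [add_mul]; omega
      _ ≤ b * b ^ l := Nat.mul_le_mul_right _ hl
      _ = _ := mul_comm _ _
  | succ r hr ih =>
    rw [digitSum_succ, pow_succ]
    calc _ < (ε r + 1) * b ^ r := by rw [add_mul]; omega
      _ ≤ b * b ^ r := Nat.mul_le_mul_right _ (h r)
      _ = _ := mul_comm _ _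

namespace IsTower

variable {ε : ℕ → ℕ} {x : ℕ → ℤ → A}

theorem digitSum_lt (hx : IsTower τ p ε x) (n r : ℕ) :
    digitSum p (fun l => ε (n + l)) r < p ^ r :=
  Substitution.digitSum_lt (fun _ => hx.lt _) r

theorem eq_translate_inflate (hp : IsConstantLength τ p) (hx : IsTower τ p ε x) (n r : ℕ) :
    x n = translate (digitSum p (fun l => ε (n + l)) r) (inflate τ p r (x (n + r))) := by
  induction r with
  | zero => rw [inflate_zero hp]; simp [digitSum]
  | succ r ih =>
    rw [ih, hx.eq (n + r), ← translate_inflate hp, translate_translate, inflate_add hp,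
      digitSum_succ, ← add_assoc]
    congr 1; push_cast; ring

theorem apply_eq_col (hp : IsConstantLength τ p) (hx : IsTower τ p ε x) {n r t : ℕ}
    (ht : digitSum p (fun l => ε (n + l)) r + t < p ^ r) :
    x n t = col τ r (x (n + r) 0) (digitSum p (fun l => ε (n + l)) r + t) := by
  rw [← inflate_nonneg_lt hp ht, hx.eq_translate_inflate hp n r, translate_apply]
  congr 1; push_cast; ring

theorem apply_zero (hp : IsConstantLength τ p) (hx : IsTower τ p ε x) (n r : ℕ) :
    x n 0 = col τ r (x (n + r) 0) (digitSum p (fun l => ε (n + l)) r) :=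
  hx.apply_eq_col hp (t := 0) (hx.digitSum_lt n r)

theorem apply_zero_one (hp : IsConstantLength τ p) (hx : IsTower τ p ε x) (n : ℕ) :
    x n 0 = col τ 1 (x (n + 1) 0) (ε n) := by
  have := hx.apply_zero hp n 1
  simpa [digitSum] using this

/-- If the digits are not eventually maximal, the blocks reach arbitrarily far to the right. -/
theorem exists_forall_lt (hp : IsConstantLength τ p) (hx : IsTower τ p ε x)
    (hfreq : ∃ᶠ n in atTop, ε n ≠ p - 1) (n t : ℕ) :
    ∃ R, ∀ r, R ≤ r → digitSum p (fun l => ε (n + l)) r + t < p ^ r := by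
  obtain ⟨N, hN, hne⟩ := frequently_atTop.1 hfreq (n + t)
  obtain ⟨l, rfl⟩ := Nat.exists_eq_add_of_le (show n ≤ N by omega)
  refine ⟨l + 1, fun r hr => ?_⟩
  have hlt := hx.lt (n + l)
  have h1 := digitSum_add_pow_lt (ε := fun l => ε (n + l)) (fun _ => hx.lt _) (l := l) (r := r)
    (by omega) (by omega)
  have h2 : l < p ^ l := Nat.lt_pow_self hp.1
  omega

/-- Towers with the same digits and infinitely many common windows agree. -/
theorem eq_of_frequently (hp : IsConstantLength τ p) {ε' : ℕ → ℕ} {x' : ℕ → ℤ → A}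
    (hx : IsTower τ p ε x) (hx' : IsTower τ p ε' x') {n : ℕ} (hε : ∀ k, n ≤ k → ε k = ε' k)
    (hfreq : ∃ᶠ k in atTop, x k (-1) = x' k (-1) ∧ x k 0 = x' k 0 ∧ x k 1 = x' k 1) :
    x n = x' n := by
  funext i
  obtain ⟨k, hk, h1, h2, h3⟩ := frequently_atTop.1 hfreq (n + i.natAbs)
  obtain ⟨r, rfl⟩ := Nat.exists_eq_add_of_le (show n ≤ k by omega)
  -- The letters at `-1`, `0`, `1` of level `n + r` fix the inflated sequence on `[-pʳ, 2pʳ)`, and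
  -- `|i| ≤ r < pʳ` puts `i` shifted by the digit sum there.
  have hr : r < p ^ r := Nat.lt_pow_self hp.1
  have hK : digitSum p (fun l => ε' (n + l)) r = digitSum p (fun l => ε (n + l)) r := by
    congr 1; funext l; exact (hε _ (by omega)).symm
  have hlt := hx.digitSum_lt n r
  rw [hx.eq_translate_inflate hp n r, hx'.eq_translate_inflate hp n r, hK, translate_apply,
    translate_apply]
  generalize digitSum p (fun l => ε (n + l)) r = K at hlt
  by_cases hi : 0 ≤ i + K
  · have := inflate_congr hp (s := 0) (t := 0) h2 h3 (i := (i + K).toNat) (n := r) (by omega)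
    rwa [mul_zero, zero_add, Int.toNat_of_nonneg hi] at this
  · have := inflate_congr hp (s := -1) (t := -1) h1 h2 (i := (i + K + (p ^ r : ℕ)).toNat) (n := r)
      (by omega)
    rw [Int.toNat_of_nonneg (by omega)] at this
    convert this using 2 <;> ring

end IsTower

/-! ### Competing cycles and determination of digits -/

theorem mul_add_lt_pow {i j m n : ℕ} (hi : i < p ^ n) (hj : j < p ^ m) :
    i * p ^ m + j < p ^ (m + n) := by
  calc i * p ^ m + j < (i + 1) * p ^ m := by rw [add_mul]; omega
    _ ≤ p ^ n * p ^ m := Nat.mul_le_mul_right _ hi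
    _ = _ := by rw [pow_add, mul_comm]

/-- Two cycles through `(a, b)`, one passing to the right of the other, give the coincidence
condition. -/
theorem coincidenceCondition_of_cycles (hp : IsConstantLength τ p) {a b : A} (hab : a ≠ b)
    {h l s i k i' j' e : ℕ} (hk : k < p ^ (h + l)) (hik : i < k)
    (hai : col τ (h + l) a i = a) (hbi : col τ (h + l) b i = b)
    (hc : col τ (h + l) a k = col τ (h + l) b k) (hj' : j' < p ^ h) (hij' : i' < j')
    (hi : i < (i' + 1) * p ^ l) (he : e < p ^ s) (hae : col τ s (col τ h a j') e = a)
    (hbe : col τ s (col τ h b j') e = b) : CoincidenceCondition τ := by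
  rw [coincidenceCondition_iff hp]
  have hf := mul_add_lt_pow hj' he
  rw [← col_add hp hj' he] at hae hbe
  set f := j' * p ^ s + e with hfdef
  have hi' : i < p ^ (h + l) := hik.trans hk
  have h0 := hp.pow_pos (s + h)
  have hcomm : s + h + (h + l) = h + l + (s + h) := by ring
  -- The cycles at `i` and `f` are composed in both orders, giving two returns in the same power.
  -- The order starting with `i` ends to the left, because `i` lies in block `i'` or earlier and `f`
  -- in block `j' > i'`; the coincidence at `k > i` stays to its right.
  refine ⟨s + h + (h + l), a, b, hab, i * p ^ (s + h) + f, f * p ^ (h + l) + i,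
    k * p ^ (s + h) + 0, ?_, ?_, ?_, mul_add_lt_pow hk h0, ?_, ?_, ?_, ?_, ?_⟩
  · calc i * p ^ (s + h) + f < (i + 1) * p ^ (s + h) := by rw [add_mul]; omega
      _ ≤ ((i' + 1) * p ^ l) * p ^ (s + h) := Nat.mul_le_mul_right _ hi
      _ = (i' + 1) * p ^ s * p ^ (h + l) := by rw [pow_add, pow_add]; ring
      _ ≤ j' * p ^ s * p ^ (h + l) := Nat.mul_le_mul_right _ (Nat.mul_le_mul_right _ hij')
      _ ≤ f * p ^ (h + l) := Nat.mul_le_mul_right _ (by omega)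
      _ ≤ _ := by omega
  · calc i * p ^ (s + h) + f < (i + 1) * p ^ (s + h) := by rw [add_mul]; omega
      _ ≤ k * p ^ (s + h) := Nat.mul_le_mul_right _ hik
  · rw [hcomm]; exact mul_add_lt_pow hf hi'
  · rw [col_add hp hi' hf, hai, hae]
  · rw [col_add hp hi' hf, hbi, hbe]
  · rw [hcomm, col_add hp hf hi', hae, hai]
  · rw [hcomm, col_add hp hf hi', hbe, hbi]
  · rw [col_add hp hk h0, col_add hp hk h0, hc]

section Determined

variable {ε ε' : ℕ → ℕ} {x y x' y' : ℕ → ℤ → A} {a b : A}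

/-- Without the coincidence condition, no pair to the right of the origin leads back to a
recurrent pair. -/
theorem col_ne_of_not_coincidenceCondition (hp : IsConstantLength τ p)
    (hnc : ¬ CoincidenceCondition τ) (hx : IsTower τ p ε x) (hy : IsTower τ p ε y)
    (hLY : ∀ n, IsLiYorkePair seqDist shift (x n) (y n))
    (hrec : ∃ᶠ n in atTop, x n 0 = a ∧ y n 0 = b) (hfreq : ∃ᶠ n in atTop, ε n ≠ p - 1)
    {l n : ℕ} (hln : x n 0 = a ∧ y n 0 = b) {j : ℕ} (hj : ε (n + l) < j) (hjp : j < p) {s e : ℕ}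
    (he : e < p ^ s) (hae : col τ s (col τ 1 (x (n + l + 1) 0) j) e = a)
    (hbe : col τ s (col τ 1 (y (n + l + 1) 0) j) e = b) : False := by
  obtain ⟨hdiff, hagree⟩ := isLiYorkePair_iff.1 (hLY n)
  obtain ⟨t, -, ht⟩ := frequently_atTop.1 hdiff 0
  obtain ⟨u, hu, hut⟩ := frequently_atTop.1 (hagree 0) 1
  have hut : x n u = y n u := by simpa using hut 0 (by simp)
  obtain ⟨R, hR⟩ := hx.exists_forall_lt hp hfreq n (t + u)
  obtain ⟨N, hN, hNa, hNb⟩ := frequently_atTop.1 hrec (n + l + 1 + R)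
  obtain ⟨g, rfl⟩ := Nat.exists_eq_add_of_le (show n + l + 1 ≤ N by omega)
  have hlev : n + l + 1 + g = n + (g + 1 + l) := by ring
  have hlt := hR (g + 1 + l) (by omega)
  have hxc := fun t h => hx.apply_eq_col hp (n := n) (r := g + 1 + l) (t := t) h
  have hyc := fun t h => hy.apply_eq_col hp (n := n) (r := g + 1 + l) (t := t) h
  rw [← hlev, hNa] at hxc
  rw [← hlev, hNb] at hyc
  -- If `a = b`, both points would carry the same block from the origin up to position `t`, where
  -- they differ.
  have hab : a ≠ b := by
    rintro rfl
    exact ht (by rw [hxc t (by omega), hyc t (by omega)])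
  have hx0 := hxc 0 (by omega)
  have hy0 := hyc 0 (by omega)
  rw [add_zero, Nat.cast_zero, hln.1] at hx0
  rw [add_zero, Nat.cast_zero, hln.2] at hy0
  have hxg := hx.apply_zero hp (n + l + 1) g
  have hyg := hy.apply_zero hp (n + l + 1) g
  rw [hNa] at hxg
  rw [hNb] at hyg
  have hKg := hx.digitSum_lt (n + l + 1) g
  -- The cycle position splits by level: `g` digits above, the digit `ε (n + l)`, and `l` digits
  -- below. Replacing that middle digit by `j` gives the competing block `j'`.
  have hpos : digitSum p (fun i => ε (n + i)) (g + 1 + l)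
      = digitSum p (fun i => ε (n + i)) l
        + p ^ l * (digitSum p (fun i => ε (n + l + 1 + i)) g * p ^ 1 + ε (n + l)) := by
    rw [show g + 1 + l = l + (1 + g) by ring, digitSum_add, digitSum_add]
    simp only [digitSum, Finset.sum_range_one, pow_zero, mul_one, add_zero, ← add_assoc]
    ring
  set K := digitSum p (fun i => ε (n + l + 1 + i)) g with hKdef
  have hj1 : j < p ^ 1 := by simpa
  refine hnc (coincidenceCondition_of_cycles hp hab (h := g + 1) (l := l) (s := s) (e := e)
    (i := digitSum p (fun i => ε (n + i)) (g + 1 + l))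
    (k := digitSum p (fun i => ε (n + i)) (g + 1 + l) + u)
    (i' := K * p ^ 1 + ε (n + l)) (j' := K * p ^ 1 + j) (by omega) (by omega) hx0.symm hy0.symm
    ?_ ?_ (by omega) ?_ he ?_ ?_)
  · rw [← hxc u (by omega), ← hyc u (by omega), hut]
  · rw [add_comm g 1]; exact mul_add_lt_pow hKg hj1
  · rw [hpos]
    have := hx.digitSum_lt n l
    rw [add_mul, one_mul, mul_comm (p ^ l)]
    omega
  · rw [add_comm g 1, col_add hp hKg hj1, ← hxg, hae]
  · rw [add_comm g 1, col_add hp hKg hj1, ← hyg, hbe]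

/-- Without the coincidence condition, the digits of two towers with a common recurrent pair are
determined by the letters at the origin. -/
theorem digit_le_of_not_coincidenceCondition (hp : IsConstantLength τ p)
    (hnc : ¬ CoincidenceCondition τ) (hx : IsTower τ p ε x) (hy : IsTower τ p ε y)
    (hx' : IsTower τ p ε' x') (hy' : IsTower τ p ε' y')
    (hLY : ∀ n, IsLiYorkePair seqDist shift (x n) (y n))
    (hrec : ∃ᶠ n in atTop, x n 0 = a ∧ y n 0 = b) (hfreq : ∃ᶠ n in atTop, ε n ≠ p - 1)
    {m m' n : ℕ} (hm : x m 0 = a ∧ y m 0 = b) (hm' : x' m' 0 = a ∧ y' m' 0 = b) (hmn : m ≤ n)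
    (hmn' : m' ≤ n) (hxx' : x (n + 1) 0 = x' (n + 1) 0) (hyy' : y (n + 1) 0 = y' (n + 1) 0) :
    ε' n ≤ ε n := by
  by_contra hlt
  obtain ⟨l, rfl⟩ := Nat.exists_eq_add_of_le hmn
  obtain ⟨s, hs⟩ := Nat.exists_eq_add_of_le hmn'
  -- From the common letters at level `n + 1`, the second tower descends through its larger digit
  -- and reaches `(a, b)` at level `m'`: this is the competing path to the right.
  refine col_ne_of_not_coincidenceCondition hp hnc hx hy hLY hrec hfreq hm (not_le.1 hlt)
    (hx'.lt _) (hx'.digitSum_lt m' s) ?_ ?_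
  · rw [hxx', ← hx'.apply_zero_one hp, hs, ← hx'.apply_zero hp, hm'.1]
  · rw [hyy', ← hy'.apply_zero_one hp, hs, ← hy'.apply_zero hp, hm'.2]

/-- Equal letters at level `n + 1` force equal digits at `n`, which force equal letters at `n`.
Descending from arbitrarily high common levels gives equality of all digits past a fixed level. -/
theorem digits_eq_of_not_coincidenceCondition (hp : IsConstantLength τ p)
    (hnc : ¬ CoincidenceCondition τ) (hx : IsTower τ p ε x) (hy : IsTower τ p ε y)
    (hx' : IsTower τ p ε' x') (hy' : IsTower τ p ε' y')
    (hLY : ∀ n, IsLiYorkePair seqDist shift (x n) (y n))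
    (hLY' : ∀ n, IsLiYorkePair seqDist shift (x' n) (y' n))
    (hrec : ∃ᶠ n in atTop, x n 0 = a ∧ y n 0 = b)
    (hrec' : ∃ᶠ n in atTop, x' n 0 = a ∧ y' n 0 = b) (hfreq : ∃ᶠ n in atTop, ε n ≠ p - 1)
    (hfreq' : ∃ᶠ n in atTop, ε' n ≠ p - 1)
    (hcom : ∃ᶠ n in atTop, x n 0 = x' n 0 ∧ y n 0 = y' n 0) :
    ∃ n₀, ∀ n, n₀ ≤ n → ε n = ε' n := by
  obtain ⟨m, hm⟩ := hrec.exists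
  obtain ⟨m', hm'⟩ := hrec'.exists
  have hdig : ∀ n, m ≤ n → m' ≤ n → x (n + 1) 0 = x' (n + 1) 0 → y (n + 1) 0 = y' (n + 1) 0 →
      ε n = ε' n := fun n h1 h2 h3 h4 => le_antisymm
    (digit_le_of_not_coincidenceCondition hp hnc hx' hy' hx hy hLY' hrec' hfreq' hm' hm h2 h1
      h3.symm h4.symm)
    (digit_le_of_not_coincidenceCondition hp hnc hx hy hx' hy' hLY hrec hfreq hm hm' h1 h2 h3 h4)
  refine ⟨max m m', fun n hn => ?_⟩
  rw [max_le_iff] at hn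
  obtain ⟨N, hN, hNc⟩ := frequently_atTop.1 hcom (n + 1)
  have desc : ∀ d k, k + d = N → n ≤ k → x k 0 = x' k 0 ∧ y k 0 = y' k 0 := by
    intro d
    induction d with
    | zero => rintro k rfl -; exact hNc
    | succ d ih =>
      intro k hk hnk
      obtain ⟨h1, h2⟩ := ih (k + 1) (by omega) (by omega)
      have h3 := hdig k (by omega) (by omega) h1 h2
      rw [hx.apply_zero_one hp, hy.apply_zero_one hp, hx'.apply_zero_one hp,
        hy'.apply_zero_one hp, h1, h2, h3]
      exact ⟨rfl, rfl⟩
  obtain ⟨d, hd⟩ := Nat.exists_eq_add_of_le hN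
  obtain ⟨h1, h2⟩ := desc d (n + 1) hd.symm (by omega)
  exact hdig n hn.1 hn.2 h1 h2

end Determined

/-! ### Pigeonhole and finiteness of orbits -/

theorem exists_frequently_eq {S : Type*} [Finite S] (f : ℕ → S) :
    ∃ s, ∃ᶠ n in atTop, f n = s := by
  by_contra! h
  obtain ⟨n, hn⟩ := (eventually_all.2 h).exists
  exact hn (f n) rfl

/-- If points with infinitely often the same state have the same image, the range is finite. -/
theorem finite_range_of_states {Q O S : Type*} [Finite S] (σ : ℕ → Q → S) (g : Q → O)
    (h : ∀ q q', (∃ᶠ n in atTop, σ n q = σ n q') → g q = g q') : (Set.range g).Finite := by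
  by_contra hinf
  have : Infinite (Set.range g) := Set.infinite_coe_iff.2 hinf
  let e := Infinite.natEmbedding (Set.range g)
  choose q hq using fun i => (e i).2
  -- Sharing a state infinitely often is not transitive, so the pigeonhole is applied at each `n` to
  -- `Nat.card S + 1` fixed points; one colliding pair of indices then recurs.
  have hpig : ∀ n, ∃ ij : Fin (Nat.card S + 1) × Fin (Nat.card S + 1),
      ij.1 ≠ ij.2 ∧ σ n (q ij.1) = σ n (q ij.2) := by
    intro n
    have := Fintype.ofFinite S
    obtain ⟨i, j, hij, he⟩ := Fintype.exists_ne_map_eq_of_card_lt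
      (fun i : Fin (Nat.card S + 1) => σ n (q i)) (by simp [Nat.card_eq_fintype_card])
    exact ⟨(i, j), hij, he⟩
  choose ij hne hσ using hpig
  obtain ⟨⟨i, j⟩, hf⟩ := exists_frequently_eq ij
  have h1 := h (q i) (q j) (hf.mono fun n hn => by have := hσ n; rwa [hn] at this)
  obtain ⟨n, hn⟩ := hf.exists
  have h2 := hne n
  rw [hn] at h2
  rw [hq, hq] at h1
  exact h2 (Fin.ext (e.injective (Subtype.ext h1)))

theorem pairOrbit_translate (e : ℤ) (x y : ℤ → A) :
    pairOrbit (translate e x, translate e y) = pairOrbit (x, y) := by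
  ext r
  simp only [pairOrbit, Set.mem_ofPred_eq, shift_zpow_eq, translate_translate]
  constructor
  · rintro ⟨n, rfl⟩; exact ⟨n + e, rfl⟩
  · rintro ⟨n, rfl⟩; exact ⟨n - e, by rw [sub_add_cancel]⟩

theorem countable_pairOrbit (q : (ℤ → A) × (ℤ → A)) : (pairOrbit q).Countable := by
  refine (Set.countable_range fun n : ℤ => ((shift ^ n) q.1, (shift ^ n) q.2)).mono ?_
  rintro r ⟨n, rfl⟩
  exact ⟨n, rfl⟩

theorem mem_pairOrbit_self (q : (ℤ → A) × (ℤ → A)) : q ∈ pairOrbit q := ⟨0, by simp⟩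

theorem countable_of_countable_orbits {S : Set ((ℤ → A) × (ℤ → A))}
    (h : (pairOrbit '' S).Countable) : S.Countable := by
  have h1 : (⋃ O ∈ pairOrbit '' S, O).Countable := by
    refine h.biUnion ?_
    rintro _ ⟨q, -, rfl⟩
    exact countable_pairOrbit q
  refine h1.mono fun q hq => ?_
  simp only [Set.mem_iUnion]
  exact ⟨_, Set.mem_image_of_mem _ hq, mem_pairOrbit_self q⟩

/-- Without the coincidence condition there are finitely many orbits of Li–Yorke pairs. -/
theorem finite_orbits_of_not_coincidenceCondition [Finite A] (hp : IsConstantLength τ p)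
    (hprim : IsPrimitive τ) (hinj : Function.Injective τ) (hinf : (subshift τ).Infinite)
    (hnc : ¬ CoincidenceCondition τ) : (pairOrbit '' liYorkePairs τ).Finite := by
  classical
  choose ε x y hx hy hq hLY using fun q : liYorkePairs τ => exists_tower hp hprim hinj hinf q.2
  choose c hc using fun q : liYorkePairs τ => exists_frequently_eq fun n => (x q n 0, y q n 0)
  rw [Set.image_eq_range]
  -- A state records whether the digits avoid being eventually `p - 1`, the chosen recurrent pair,
  -- and the letters at `-1`, `0`, `1` that determine a tower once its digits are known.
  refine finite_range_of_states (S := Bool × (A × A) × (A × A × A) × (A × A × A))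
    (fun n q => (decide (∃ᶠ n in atTop, ε q n ≠ p - 1), c q,
      (x q n (-1), x q n 0, x q n 1), (y q n (-1), y q n 0, y q n 1))) _ fun q q' hqq' => ?_
  simp only [Prod.mk.injEq, decide_eq_decide] at hqq'
  have hrec : ∀ q, ∃ᶠ n in atTop, x q n 0 = (c q).1 ∧ y q n 0 = (c q).2 := fun q =>
    (hc q).mono fun n hn => ⟨congrArg Prod.fst hn, congrArg Prod.snd hn⟩
  obtain ⟨n₀, hn₀⟩ : ∃ n₀, ∀ n, n₀ ≤ n → ε q n = ε q' n := by
    obtain ⟨-, hflag, hcc, -⟩ := hqq'.exists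
    by_cases hf : ∃ᶠ n in atTop, ε q n ≠ p - 1
    · refine digits_eq_of_not_coincidenceCondition hp hnc (hx q) (hy q) (hx q') (hy q') (hLY q)
        (hLY q') (hrec q) (hcc ▸ hrec q') hf (hflag.1 hf) (hqq'.mono fun n hn => ?_)
      exact ⟨hn.2.2.1.2.1, hn.2.2.2.2.1⟩
    -- Here both addresses end in the constant digit `p - 1`, so they agree without any coincidence
    -- argument.
    · have hf' := mt hflag.2 hf
      rw [not_frequently] at hf hf'
      obtain ⟨n₀, h⟩ := eventually_atTop.1 (hf.and hf')
      refine ⟨n₀, fun n hn => ?_⟩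
      obtain ⟨h1, h2⟩ := h n hn
      rw [not_not.1 h1, not_not.1 h2]
  have hxx := (hx q).eq_of_frequently hp (hx q') hn₀ (hqq'.mono fun n hn => hn.2.2.1)
  have hyy := (hy q).eq_of_frequently hp (hy q') hn₀ (hqq'.mono fun n hn => hn.2.2.2)
  -- The two points of a pair share their digits, so passing to level `n₀` translates both by the
  -- same amount and keeps the orbit.
  have horb : ∀ q, pairOrbit q.1
      = pairOrbit (inflate τ p n₀ (x q n₀), inflate τ p n₀ (y q n₀)) := by
    intro q
    have h1 := (hx q).eq_translate_inflate hp 0 n₀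
    have h2 := (hy q).eq_translate_inflate hp 0 n₀
    rw [zero_add] at h1 h2
    rw [hq q, h1, h2, pairOrbit_translate]
  rw [horb q, horb q', hxx, hyy]

end Substitution

theorem proposition3p8 {A : Type*} [Finite A] (τ : A → List A) (p : ℕ)
    (hlen : Substitution.IsConstantLength τ p)
    (hprim : Substitution.IsPrimitive τ)
    (hinj : Function.Injective τ)
    (hinf : (Substitution.subshift τ).Infinite) :
    ((Substitution.pairOrbit '' Substitution.liYorkePairs τ).Finite ∨
      ¬ (Substitution.pairOrbit '' Substitution.liYorkePairs τ).Countable) ∧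
    (¬ (Substitution.liYorkePairs τ).Countable ↔ Substitution.CoincidenceCondition τ) := by
  by_cases h : Substitution.CoincidenceCondition τ
  · have h1 := Substitution.not_countable_of_coincidenceCondition hlen hprim hinj hinf h
    exact ⟨Or.inr (mt Substitution.countable_of_countable_orbits h1), iff_of_true h1 h⟩
  · have h1 := Substitution.finite_orbits_of_not_coincidenceCondition hlen hprim hinj hinf h
    exact ⟨Or.inl h1, iff_of_false
      (not_not.2 (Substitution.countable_of_countable_orbits h1.countable)) h⟩
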